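/- Let $\mathcal X$ be any set, let $\mathcal Y$ be a finite set with $|\mathcal Y|=k>2$, and let $\mathcal H\subseteq\mathcal Y^{\mathcal X}$ have finite Natarajan dimension $\mathrm{Ndim}(\mathcal H)$: the largest size of a finite $S\subseteq\mathcal X$ for which there are $f_0,f_1:S\to\mathcal Y$ with $f_0(x)\ne f_1(x)$ for all $x\in S$ such that for every $R\subseteq S$ some $h\in\mathcal H$ equals $f_0$ on $R$ and $f_1$ on $S\setminus R$. A quantum learner with $m$ examples receives $|\psi\rangle^{\otimes m}$, measures it, and outputs a hypothesis $g:\mathcal X\to\mathcal Y$ determined by the measurement outcome. * It is an $(\epsilon,\delta)$-quantum PAC learner for $\mathcal H$ if for every discrete probability distribution $D$ on $\mathcal X$ and every $h^\star\in\mathcal H$, when $|\psi\rangle=\sum_{x}\sqrt{D(x)}\,|x,h^\star(x)\rangle$, with probability at least $1-\delta$ its output satisfies $\Pr_{x\sim D}[g(x)\ne h^\star(x)]\le\epsilon$. * It is an $(\epsilon,\delta)$-quantum agnostic learner for $\mathcal H\neq\emptyset$ if for every discrete probability distribution $D$ on $\mathcal X\times\mathcal Y$, when $|\psi\rangle=\sum_{x,y}\sqrt{D(x,y)}\,|x,y\rangle$,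 with probability at least $1-\delta$ its output satisfies $\Pr_{(x,y)\sim D}[g(x)\ne y]-\inf_{h\in\mathcal H}\Pr_{(x,y)\sim D}[h(x)\ne y]\le\epsilon$. Then the following hold. 1. For every $\epsilon_0<1$ there is a constant $C>0$, depending only on $\epsilon_0$ (so $C$ is absolute if, for example, $\epsilon_0=1/2$), such that for all $\mathcal X,\mathcal Y,\mathcal H$ as above, all $0<\epsilon\le\epsilon_0$ and $0<\delta<1$, and every integer $$m\ \ge\ C\cdot\frac{\mathrm{Ndim}(\mathcal H)\,\log(k)\,\log(1/\epsilon)+\log(1/\delta)}{\epsilon},$$ there is an $(\epsilon,\delta)$-quantum PAC learner for $\mathcal H$ that uses $m$ quantum examples. 2. There is an absolute constant $C>0$ such that for all $\mathcal X,\mathcal Y$ and nonempty $\mathcal H$ as above, all $0<\epsilon<1$ and $0<\delta<1$, and every integer $$m\ \ge\ C\cdot\frac{\mathrm{Ndim}(\mathcal H)\,\log(k)+\log(1/\delta)}{\epsilon^2},$$ there is an $(\epsilon,\delta)$-quantum agnostic learner for $\mathcal H$ that uses $m$ quantum examples. In both cases the learner can be taken to measure each example in the computational basis and to run a classical learner,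 that is, a function $(\mathcal X\times\mathcal Y)^m\to\mathcal Y^{\mathcal X}$, on the resulting $m$ classical examples. -/

import Mathlib

open scoped ENNReal

noncomputable section

namespace QuantumBatch

/-! ### Natarajan dimension -/

/-- A finite set `S` is N-shattered by `H`. -/
def NShatters {X Y : Type*} (H : Set (X → Y)) (S : Finset X) : Prop :=
  ∃ f₀ f₁ : X → Y, (∀ x ∈ S, f₀ x ≠ f₁ x) ∧
    ∀ R : Finset X, R ⊆ S → ∃ h ∈ H, (∀ x ∈ R, h x = f₀ x) ∧
      ∀ x ∈ S, x ∉ R → h x = f₁ x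

/-- The Natarajan dimension: the supremum of the sizes of N-shattered finite sets. -/
def natarajanDim {X Y : Type*} (H : Set (X → Y)) : ℕ∞ :=
  ⨆ (S : Finset X) (_ : NShatters H S), (S.card : ℕ∞)

/-! ### State spaces, quantum examples, and several copies of a state -/

/-- The Hilbert space `ℓ²(α)` with computational basis indexed by `α`. For finite `α` it is the
usual finite-dimensional space `ℂ^α`. -/
abbrev StateSpace (α : Type*) : Type _ := lp (fun _ : α => ℂ) 2

/-- The computational basis vector `|a⟩`. -/
def ket {α : Type*} (a : α) : StateSpace α :=
  letI := Classical.decEq α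
  lp.single 2 a (1 : ℂ)

theorem ket_apply {α : Type*} [DecidableEq α] (a b : α) :
    ket a b = if b = a then (1 : ℂ) else 0 := by
  unfold ket
  by_cases hb : b = a
  · subst hb
    simp
  · simp [hb]

theorem memℓp_sqrt_pmf {α : Type*} (P : PMF α) :
    Memℓp (fun a : α => ((Real.sqrt (P a).toReal : ℝ) : ℂ)) 2 := by
  apply memℓp_gen
  have h : Summable fun a => (P a).toReal := ENNReal.summable_toReal P.tsum_coe_ne_top
  refine h.congr fun a => ?_
  simp [Complex.norm_real, abs_of_nonneg, Real.sqrt_nonneg]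

/-- The quantum example `∑ₐ √P(a) |a⟩` of a distribution `P`. For a distribution `P` on `X × Y`
this is the example `∑_{(x,y)} √P(x,y) |x,y⟩` given to an agnostic learner. -/
def quantumExample {α : Type*} (P : PMF α) : StateSpace α :=
  ⟨fun a => ((Real.sqrt (P a).toReal : ℝ) : ℂ), memℓp_sqrt_pmf P⟩

/-- The distribution of `(x, h x)` when `x` is drawn from `D`. -/
def labeled {X Y : Type*} (D : PMF X) (h : X → Y) : PMF (X × Y) :=
  D.map fun x => (x, h x)

theorem labeled_apply {X Y : Type*} [DecidableEq Y] (D : PMF X) (h : X → Y) (x : X) (y : Y) :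
    labeled D h (x, y) = if y = h x then D x else 0 := by
  classical
  unfold labeled
  rw [PMF.map_apply]
  by_cases hy : y = h x
  · subst hy
    rw [tsum_eq_single x]
    · simp
    · intro x' hx'
      simp [Ne.symm hx']
  · simp only [hy, if_false, ENNReal.tsum_eq_zero, Prod.mk.injEq, ite_eq_right_iff]
    rintro x' ⟨rfl, h2⟩
    exact absurd h2 hy

/-- The quantum example `∑ₓ √D(x) |x, h x⟩` given to a PAC learner with target `h`. -/
def realizableExample {X Y : Type*} (D : PMF X) (h : X → Y) : StateSpace (X × Y) :=
  quantumExample (labeled D h)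

theorem realizableExample_apply {X Y : Type*} [DecidableEq Y] (D : PMF X) (h : X → Y)
    (x : X) (y : Y) :
    realizableExample D h (x, y) = if y = h x then ((Real.sqrt (D x).toReal : ℝ) : ℂ) else 0 := by
  change ((Real.sqrt (labeled D h (x, y)).toReal : ℝ) : ℂ) = _
  rw [labeled_apply]
  split_ifs <;> simp

theorem memℓp_tensorPow {α : Type*} (ψ : StateSpace α) (m : ℕ) :
    Memℓp (fun z : Fin m → α => ∏ i, ψ (z i)) 2 := by
  classical
  have hs : Summable fun a => ‖ψ a‖ ^ 2 := by
    simpa using (lp.memℓp ψ).summable (by norm_num)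
  apply memℓp_gen' (C := (∑' a, ‖ψ a‖ ^ 2) ^ m)
  intro s
  have h1 : ∀ z : Fin m → α,
      ‖∏ i, ψ (z i)‖ ^ (2 : ℝ≥0∞).toReal = ∏ i, ‖ψ (z i)‖ ^ 2 := by
    intro z
    simp [norm_prod, Finset.prod_pow]
  simp only [h1]
  set T : Finset α := s.biUnion fun z => Finset.univ.image z with hT
  calc ∑ z ∈ s, ∏ i, ‖ψ (z i)‖ ^ 2
      ≤ ∑ z ∈ Fintype.piFinset (fun _ : Fin m => T), ∏ i, ‖ψ (z i)‖ ^ 2 := by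
        apply Finset.sum_le_sum_of_subset_of_nonneg
        · intro z hz
          rw [Fintype.mem_piFinset]
          intro i
          exact Finset.mem_biUnion.2 ⟨z, hz, Finset.mem_image_of_mem _ (Finset.mem_univ i)⟩
        · intros; positivity
    _ = ∏ _i : Fin m, ∑ a ∈ T, ‖ψ a‖ ^ 2 :=
        (Finset.prod_univ_sum (fun _ => T) (fun _ a => ‖ψ a‖ ^ 2)).symm
    _ ≤ (∑' a, ‖ψ a‖ ^ 2) ^ m := by
        rw [Finset.prod_const, Finset.card_univ, Fintype.card_fin]
        exact pow_le_pow_left₀ (by positivity)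
          (hs.sum_le_tsum T fun a _ => by positivity) m

/-- The state `ψ ⊗ ⋯ ⊗ ψ` (`m` factors) of `m` copies of a system in state `ψ`. The `m`-fold
tensor power of `ℓ²(α)` is `ℓ²(Fin m → α)`, with `|z₁⟩ ⊗ ⋯ ⊗ |zₘ⟩ = |z₁,…,zₘ⟩`. -/
def tensorPow {α : Type*} (ψ : StateSpace α) (m : ℕ) : StateSpace (Fin m → α) :=
  ⟨fun z => ∏ i, ψ (z i), memℓp_tensorPow ψ m⟩

/-! ### Measurements -/

/-- A quantum measurement on `E` with outcomes in `J`: measurement operators `Mⱼ` with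
`∑ⱼ Mⱼ† Mⱼ = I`. The sum is taken in the strong operator topology, which is the usual
meaning when infinitely many outcomes are possible. -/
structure Measurement (E : Type*) [NormedAddCommGroup E] [InnerProductSpace ℂ E]
    [CompleteSpace E] (J : Type*) where
  /-- the measurement operators -/
  op : J → E →L[ℂ] E
  complete : ∀ ψ : E,
    HasSum (fun j => (ContinuousLinearMap.adjoint (op j) ∘L op j) ψ) ψ

/-- The probability `⟨ψ| Mⱼ† Mⱼ |ψ⟩` of the outcome `j`. -/
def Measurement.outcomeProb {E J : Type*} [NormedAddCommGroup E] [InnerProductSpace ℂ E]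
    [CompleteSpace E] (M : Measurement E J) (ψ : E) (j : J) : ℝ≥0∞ :=
  ENNReal.ofReal
    (RCLike.re (inner ℂ ψ ((ContinuousLinearMap.adjoint (M.op j) ∘L M.op j) ψ)))

/-- The probability that the outcome lies in `S`. -/
def Measurement.prob {E J : Type*} [NormedAddCommGroup E] [InnerProductSpace ℂ E]
    [CompleteSpace E] (M : Measurement E J) (ψ : E) (S : Set J) : ℝ≥0∞ :=
  ∑' j : S, M.outcomeProb ψ j

theorem rankOne_ket_apply {α : Type*} (a : α) (ψ : StateSpace α) :
    InnerProductSpace.rankOne ℂ (ket a) (ket a) ψ = ψ a • ket a := by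
  classical
  rw [InnerProductSpace.rankOne_apply]
  congr 1
  unfold ket
  rw [lp.inner_single_left]
  simp

theorem computationalBasis_complete {α : Type*} (ψ : StateSpace α) :
    HasSum (fun a => (ContinuousLinearMap.adjoint (InnerProductSpace.rankOne ℂ (ket a) (ket a)) ∘L
      InnerProductSpace.rankOne ℂ (ket a) (ket a)) ψ) ψ := by
  classical
  have h := lp.hasSum_single (E := fun _ : α => ℂ) (p := 2) (by norm_num) ψ
  have key : ∀ a, (ContinuousLinearMap.adjoint (InnerProductSpace.rankOne ℂ (ket a) (ket a)) ∘L
      InnerProductSpace.rankOne ℂ (ket a) (ket a)) ψ = lp.single 2 a (ψ a) := by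
    intro a
    have hone : ket a a = (1 : ℂ) := by simp [ket_apply]
    rw [InnerProductSpace.adjoint_rankOne, ContinuousLinearMap.comp_apply,
      rankOne_ket_apply a ψ, map_smul, rankOne_ket_apply, hone, one_smul]
    apply lp.ext
    funext b
    by_cases hb : b = a
    · subst hb
      simp [ket_apply]
    · rw [lp.single_apply_ne _ _ _ hb]
      simp [ket_apply, hb]
  simpa only [key] using h

/-- The measurement in the computational basis, with operators `|a⟩⟨a|`. -/
def computationalBasis (α : Type*) : Measurement (StateSpace α) α where
  op a := InnerProductSpace.rankOne ℂ (ket a) (ket a)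
  complete := computationalBasis_complete

/-! ### Learners -/

/-- A quantum learner that uses `m` quantum examples: a measurement of the `m` examples (any
preceding unitary evolution, possibly with ancillas, is absorbed in the measurement operators)
and a rule that turns the classical outcome into a hypothesis. -/
structure QuantumLearner (X : Type*) (Y : Type*) (m : ℕ) where
  /-- the classical outcomes -/
  Outcome : Type*
  measurement : Measurement (StateSpace (Fin m → X × Y)) Outcome
  output : Outcome → (X → Y)

/-- The generalization error `P_{x ∼ D}(g x ≠ h x)`. -/
def pacLoss {X Y : Type*} (D : PMF X) (h g : X → Y) : ℝ :=
  (D.toOuterMeasure {x | g x ≠ h x}).toReal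

/-- The error `P_{(x,y) ∼ D}(g x ≠ y)`. -/
def err {X Y : Type*} (D : PMF (X × Y)) (g : X → Y) : ℝ :=
  (D.toOuterMeasure {z | g z.1 ≠ z.2}).toReal

/-- The regret of `g` relative to the best hypothesis in `H`. -/
def regret {X Y : Type*} (H : Set (X → Y)) (D : PMF (X × Y)) (g : X → Y) : ℝ :=
  err D g - ⨅ h : H, err D h

/-- `L` is an `(ε, δ)`-quantum PAC learner for `H`. -/
def QuantumLearner.IsPAC {X Y : Type*} {m : ℕ} (L : QuantumLearner X Y m) (ε δ : ℝ)
    (H : Set (X → Y)) : Prop :=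
  ∀ (D : PMF X), ∀ h ∈ H,
    ENNReal.ofReal (1 - δ) ≤ L.measurement.prob (tensorPow (realizableExample D h) m)
      {j | pacLoss D h (L.output j) ≤ ε}

/-- `L` is an `(ε, δ)`-quantum agnostic learner for `H`. -/
def QuantumLearner.IsAgnostic {X Y : Type*} {m : ℕ} (L : QuantumLearner X Y m) (ε δ : ℝ)
    (H : Set (X → Y)) : Prop :=
  ∀ D : PMF (X × Y),
    ENNReal.ofReal (1 - δ) ≤ L.measurement.prob (tensorPow (quantumExample D) m)
      {j | regret H D (L.output j) ≤ ε}

/-- The quantum learner that measures each of the `m` examples in the computational basis and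
runs the classical learner `A` on the resulting training set. -/
def QuantumLearner.measureThenRun {X Y : Type*} {m : ℕ} (A : (Fin m → X × Y) → (X → Y)) :
    QuantumLearner X Y m where
  Outcome := Fin m → X × Y
  measurement := computationalBasis (Fin m → X × Y)
  output := A

end QuantumBatch

end

/-!
Both learners measure every example in the computational basis. By the Born rule the outcome is an
independent sample from the underlying distribution (`prob_computationalBasis`), so the claim is
about classical learners: one that outputs a consistent hypothesis in the realizable case, and
one that minimizes the empirical error in the agnostic case.

Write `k` for the number of labels and `d` for the Natarajan dimension. The class has at most
`t⁻¹ ^ d * exp (t k² n)` patterns on `n` points, for every `0 < t ≤ 1` (`card_le_of_nshatters`).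
The induction is Natarajan's: functions with two different extensions to a new point form a class of
smaller dimension. Keeping `t` free avoids binomial sums, and it later serves to absorb the
exponential factor into a quantity already at hand.

Symmetrization (`toOuterMeasure_le_of_symmetrization`) reduces either bad event to counting, for two
fixed samples, the ways of exchanging entries between them that produce a deviation. All
probabilities are sums over sample sequences in `ℝ≥0∞`, so measurability plays no role even when `X`
is uncountable.

In the realizable case a fixed pattern with `r` errors has all of them in the ghost sample for a
fraction at most `2⁻ʳ` of the exchanges, and a union bound over the patterns on `2 m` points is
enough (`toOuterMeasure_consistent_le`).

In the agnostic case the union bound would cost a factor `log (1 / ε)`, and chaining is used instead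
(`card_chaining_le`). The patterns of loss differences are approximated by nets that are separated
by `4⁻ʲ m` in Hamming distance. Reading a separated set along a few random coordinates and applying
the growth bound there gives at most `e^{1/2} (8 k² 4ʲ) ^ (2 d)` net points
(`card_separated_le`). Hoeffding's inequality for the links between consecutive nets, at
thresholds proportional to `(3/4)ʲ`, has an exponent that grows like `(9/4)ʲ`, which beats the
linear growth in `j` of the logarithm of the number of links.
-/

noncomputable section

namespace QuantumBatch

/-! ### Independent samples and the computational-basis measurement -/

/-- A Fubini formula for sums over finite sequences. In `ℝ≥0∞` it needs no summability. -/
theorem tsum_pi_prod {α : Type*} {m : ℕ} (f : Fin m → α → ℝ≥0∞) :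
    ∑' z : Fin m → α, ∏ i, f i (z i) = ∏ i, ∑' a, f i a := by
  induction m with
  | zero => simp
  | succ m ih =>
    rw [← (Fin.consEquiv fun _ => α).tsum_eq, ENNReal.tsum_prod', Fin.prod_univ_succ,
      ← ih fun i => f i.succ, ← ENNReal.tsum_mul_right]
    refine tsum_congr fun a => ?_
    rw [← ENNReal.tsum_mul_left]
    refine tsum_congr fun z => ?_
    simp [Fin.consEquiv, Fin.prod_univ_succ]

/-- The distribution of `m` independent draws from `P`. -/
def iid {α : Type*} (P : PMF α) (m : ℕ) : PMF (Fin m → α) :=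
  ⟨fun z => ∏ i, P (z i), by
    have h := tsum_pi_prod (m := m) fun _ => P
    simp only [PMF.tsum_coe, Finset.prod_const_one] at h
    exact h ▸ ENNReal.summable.hasSum⟩

theorem iid_apply {α : Type*} (P : PMF α) (m : ℕ) (z : Fin m → α) :
    iid P m z = ∏ i, P (z i) := rfl

theorem outcomeProb_computationalBasis {α : Type*} (ψ : StateSpace α) (a : α) :
    (computationalBasis α).outcomeProb ψ a = ENNReal.ofReal (‖ψ a‖ ^ 2) := by
  classical
  unfold Measurement.outcomeProb computationalBasis
  simp only [ContinuousLinearMap.comp_apply]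
  rw [ContinuousLinearMap.adjoint_inner_right, rankOne_ket_apply, inner_smul_left,
    inner_smul_right]
  have h1 : inner ℂ (ket a) (ket a) = (1 : ℂ) := by
    unfold ket
    rw [lp.inner_single_left]
    simp
  rw [h1, mul_one, ← Complex.normSq_eq_conj_mul_self, Complex.normSq_eq_norm_sq]
  exact congrArg _ (Complex.ofReal_re _)

/-- The Born rule: measuring `m` quantum examples of `P` in the computational basis gives `m`
independent draws from `P`. -/
theorem prob_computationalBasis {α : Type*} (P : PMF α) (m : ℕ) (S : Set (Fin m → α)) :
    (computationalBasis (Fin m → α)).prob (tensorPow (quantumExample P) m) S =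
      (iid P m).toOuterMeasure S := by
  rw [PMF.toOuterMeasure_apply, Measurement.prob, ← tsum_subtype]
  refine tsum_congr fun z => ?_
  rw [outcomeProb_computationalBasis, iid_apply]
  change ENNReal.ofReal (‖∏ i, ((Real.sqrt (P (z.1 i)).toReal : ℝ) : ℂ)‖ ^ 2) = _
  rw [norm_prod, ← Finset.prod_pow, ENNReal.ofReal_prod_of_nonneg fun _ _ => by positivity]
  refine Finset.prod_congr rfl fun i _ => ?_
  rw [Complex.norm_real, Real.norm_eq_abs, sq_abs, Real.sq_sqrt ENNReal.toReal_nonneg,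
    ENNReal.ofReal_toReal (P.apply_ne_top _)]

/-- A lower bound on the probability of `S` from an upper bound on that of its complement. -/
theorem ofReal_one_sub_le_toOuterMeasure {α : Type*} (P : PMF α) {S : Set α} {δ : ℝ}
    (h0 : 0 ≤ δ) (h : P.toOuterMeasure Sᶜ ≤ ENNReal.ofReal δ) :
    ENNReal.ofReal (1 - δ) ≤ P.toOuterMeasure S := by
  have h1 : P.toOuterMeasure (S ∪ Sᶜ) = 1 :=
    (P.toOuterMeasure_apply_eq_one_iff _).2 (by simp)
  rw [ENNReal.ofReal_sub _ h0, ENNReal.ofReal_one, tsub_le_iff_right, ← h1]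
  exact (MeasureTheory.measure_union_le _ _).trans (by gcongr)

/-! ### The growth function of a class of finite Natarajan dimension -/

theorem natarajanDim_le_iff {X Y : Type*} {H : Set (X → Y)} {d : ℕ} :
    natarajanDim H ≤ d ↔ ∀ S, NShatters H S → S.card ≤ d := by
  simp [natarajanDim]

/-- If every function in `G` extends to one in `H` both by the value `y` and by the value `y'` at
the new point, then a set shattered by `G` stays shattered after adding that point. -/
theorem NShatters.cons {n : ℕ} {Y : Type*} {G : Set (Fin n → Y)} {H : Set (Fin (n + 1) → Y)}
    {y y' : Y} (hy : y ≠ y') (h : ∀ g ∈ G, Fin.cons y g ∈ H ∧ Fin.cons y' g ∈ H)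
    {S : Finset (Fin n)} (hS : NShatters G S) :
    NShatters H (Finset.cons 0 (S.map (Fin.succEmb n)) (by simp)) := by
  classical
  obtain ⟨f₀, f₁, hne, hsh⟩ := hS
  refine ⟨Fin.cons y f₀, Fin.cons y' f₁, ?_, ?_⟩
  · intro x hx
    rw [Finset.mem_cons, Finset.mem_map] at hx
    obtain rfl | ⟨i, hi, rfl⟩ := hx
    · simpa using hy
    · simpa using hne i hi
  · intro R _
    obtain ⟨g, hg, hg0, hg1⟩ := hsh (S.filter fun i => i.succ ∈ R) (Finset.filter_subset _ _)
    refine ⟨Fin.cons (if 0 ∈ R then y else y') g, ?_, ?_, ?_⟩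
    · split_ifs
      exacts [(h g hg).1, (h g hg).2]
    · intro x hxR
      refine Fin.cases (fun h0 => by simp [h0]) (fun i hi => ?_) x hxR
      rename_i hR
      have := hR hi
      simp only [Finset.mem_cons, Finset.mem_map, Fin.coe_succEmb] at this
      obtain h' | ⟨j, hj, hji⟩ := this
      · exact absurd h' (Fin.succ_ne_zero i)
      · obtain rfl := Fin.succ_injective _ hji
        simpa using hg0 j (by simp [hj, hi])
    · intro x hx hxR
      rw [Finset.mem_cons, Finset.mem_map] at hx
      obtain rfl | ⟨i, hi, rfl⟩ := hx
      · simp [hxR]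
      · simpa using hg1 i hi (fun h => hxR (by simpa using (Finset.mem_filter.1 h).2))

/-- A set shattered by the restrictions of `G` to the points after the first one is shattered by
`G` itself. -/
theorem NShatters.map_succ {n : ℕ} {Y : Type*} {G : Set (Fin (n + 1) → Y)}
    {S : Finset (Fin n)} (hS : NShatters (Fin.tail '' G) S) :
    NShatters G (S.map (Fin.succEmb n)) := by
  classical
  obtain ⟨f₀, f₁, hne, hsh⟩ := hS
  by_cases hYn : Nonempty Y
  swap
  · obtain ⟨_, ⟨g, _, _⟩, _⟩ := hsh ∅ (by simp)
    exact absurd ⟨g 0⟩ hYn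
  obtain ⟨y⟩ := hYn
  refine ⟨Fin.cons y f₀, Fin.cons y f₁, ?_, ?_⟩
  · intro x hx
    obtain ⟨i, hi, rfl⟩ := Finset.mem_map.1 hx
    simpa using hne i hi
  · intro R hR
    obtain ⟨_, ⟨g, hg, rfl⟩, hg0, hg1⟩ :=
      hsh (S.filter fun i => i.succ ∈ R) (Finset.filter_subset _ _)
    refine ⟨g, hg, ?_, ?_⟩
    · intro x hx
      obtain ⟨i, hi, rfl⟩ := Finset.mem_map.1 (hR hx)
      simpa [Fin.tail] using hg0 i (Finset.mem_filter.2 ⟨hi, by simpa using hx⟩)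
    · intro x hx hxR
      obtain ⟨i, hi, rfl⟩ := Finset.mem_map.1 hx
      simpa [Fin.tail] using
        hg1 i hi fun h => hxR (by simpa using (Finset.mem_filter.1 h).2)

/-- A form of the Natarajan lemma with a free parameter `t`; optimizing over `t` gives the usual
bound `(e n k² / d) ^ d`. -/
theorem card_le_of_nshatters {Y : Type*} [Fintype Y] {t : ℝ} (ht : 0 < t) (ht1 : t ≤ 1) :
    ∀ (n d : ℕ) (G : Finset (Fin n → Y)),
      (∀ S, NShatters (G : Set (Fin n → Y)) S → S.card ≤ d) →
      (G.card : ℝ) ≤ t⁻¹ ^ d * (1 + t * (Fintype.card Y : ℝ) ^ 2) ^ n := by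
  classical
  have htinv : 1 ≤ t⁻¹ := (one_le_inv₀ ht).2 ht1
  intro n
  induction n with
  | zero =>
    intro d G _
    have h1 : (G.card : ℝ) ≤ 1 := by
      exact_mod_cast (Finset.card_le_univ G).trans (by simp)
    simpa using h1.trans (one_le_pow₀ htinv)
  | succ n ih =>
    intro d G hG
    set G' : Finset (Fin n → Y) := G.image Fin.tail with hG'
    set P : Y × Y → Finset (Fin n → Y) := fun p =>
      G'.filter fun g => (Fin.cons p.1 g : Fin (n + 1) → Y) ∈ G ∧
        (Fin.cons p.2 g : Fin (n + 1) → Y) ∈ G with hP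
    set O : Finset (Y × Y) := (Finset.univ : Finset Y).offDiag with hO
    -- A restriction with `j` extensions is counted at most `1 + j (j - 1)` times on the right.
    have hcount : G.card ≤ G'.card + ∑ p ∈ O, (P p).card := by
      have e1 : G.card = ∑ g ∈ G', (Finset.univ.filter fun y : Y =>
          (Fin.cons y g : Fin (n + 1) → Y) ∈ G).card := by
        rw [Finset.card_eq_sum_card_fiberwise (f := Fin.tail) (t := G')
          (fun g hg => Finset.mem_coe.2 (Finset.mem_image_of_mem _ hg))]
        refine Finset.sum_congr rfl fun g _ => ?_
        refine Finset.card_bij (fun f _ => f 0) ?_ ?_ ?_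
        · intro f hf
          obtain ⟨hf, rfl⟩ := Finset.mem_filter.1 hf
          simpa using hf
        · intro f hf f' hf' h0
          rw [← Fin.cons_self_tail f, ← Fin.cons_self_tail f', (Finset.mem_filter.1 hf).2,
            (Finset.mem_filter.1 hf').2, h0]
        · intro y hy
          exact ⟨Fin.cons y g, Finset.mem_filter.2 ⟨(Finset.mem_filter.1 hy).2, by simp⟩, by simp⟩
      have e2 : ∑ p ∈ O, (P p).card = ∑ g ∈ G', ((Finset.univ.filter fun y : Y =>
          (Fin.cons y g : Fin (n + 1) → Y) ∈ G).offDiag).card := by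
        simp only [hP, Finset.card_filter]
        rw [Finset.sum_comm]
        refine Finset.sum_congr rfl fun g _ => ?_
        rw [← Finset.card_filter]
        congr 1
        ext p
        simp [hO]
        tauto
      rw [e1, e2, Finset.card_eq_sum_ones, ← Finset.sum_add_distrib]
      refine Finset.sum_le_sum fun g _ => ?_
      rw [Finset.offDiag_card]
      generalize (Finset.univ.filter fun y : Y =>
          (Fin.cons y g : Fin (n + 1) → Y) ∈ G).card = j
      rcases j with _ | _ | j
      · simp
      · simp
      · have : (j + 1 + 1) * (j + 1 + 1) - (j + 1 + 1) = (j + 1 + 1) * (j + 1) := by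
          rw [Nat.sub_eq_iff_eq_add (by nlinarith)]; ring
        rw [this]; nlinarith
    have hG'le : (G'.card : ℝ) ≤ t⁻¹ ^ d * (1 + t * (Fintype.card Y : ℝ) ^ 2) ^ n := by
      refine ih d G' fun S hS => ?_
      have := hG _ (NShatters.map_succ (G := (G : Set (Fin (n + 1) → Y)))
        (by simpa [hG'] using hS))
      simpa using this
    have hPle : ∀ p ∈ O, ((P p).card : ℝ) ≤
        t * (t⁻¹ ^ d * (1 + t * (Fintype.card Y : ℝ) ^ 2) ^ n) := by
      intro p hp
      have hne : p.1 ≠ p.2 := (Finset.mem_offDiag.1 hp).2.2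
      have hsh : ∀ S, NShatters (P p : Set (Fin n → Y)) S → S.card + 1 ≤ d := by
        intro S hS
        have := hG _ (NShatters.cons hne (H := (G : Set (Fin (n + 1) → Y)))
          (fun g hg => (Finset.mem_filter.1 (Finset.mem_coe.1 hg)).2) hS)
        simpa using this
      rcases d with _ | d
      · have : P p = ∅ := by
          by_contra hne'
          obtain ⟨g, hg⟩ := Finset.nonempty_iff_ne_empty.2 hne'
          have := hsh ∅ ⟨fun _ => p.1, fun _ => p.2, by simp, fun R hR => ⟨g, hg, by
            simp [Finset.subset_empty.1 hR], by simp⟩⟩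
          omega
        rw [this]
        simp only [Finset.card_empty, Nat.cast_zero]
        positivity
      · refine (ih d (P p) fun S hS => by have := hsh S hS; omega).trans (le_of_eq ?_)
        linear_combination (-(t⁻¹ ^ d * (1 + t * (Fintype.card Y : ℝ) ^ 2) ^ n)) *
          mul_inv_cancel₀ ht.ne'
    have hOle : (O.card : ℝ) ≤ (Fintype.card Y : ℝ) ^ 2 := by
      rw [sq]
      exact_mod_cast (Finset.card_le_univ O).trans (by simp)
    set F : ℝ := t⁻¹ ^ d * (1 + t * (Fintype.card Y : ℝ) ^ 2) ^ n
    have hF : 0 ≤ F := by positivity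
    calc (G.card : ℝ) ≤ G'.card + ∑ p ∈ O, ((P p).card : ℝ) := by exact_mod_cast hcount
      _ ≤ F + ∑ _p ∈ O, t * F := add_le_add hG'le (Finset.sum_le_sum hPle)
      _ = F + O.card * (t * F) := by rw [Finset.sum_const, nsmul_eq_mul]
      _ ≤ F + (Fintype.card Y : ℝ) ^ 2 * (t * F) := by gcongr
      _ = t⁻¹ ^ d * (1 + t * (Fintype.card Y : ℝ) ^ 2) ^ (n + 1) := by
        simp only [F]; ring

/-- The functions in `H`, read along a finite sequence of points. -/
def patterns {X Y : Type*} {n : ℕ} (H : Set (X → Y)) (x : Fin n → X) : Set (Fin n → Y) :=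
  (fun h i => h (x i)) '' H

/-- Indices at which the patterns are shattered carry distinct points, and these form a shattered
set of the same size. -/
theorem NShatters.of_patterns {X Y : Type*} {n : ℕ} {H : Set (X → Y)} {x : Fin n → X}
    {S : Finset (Fin n)} (hS : NShatters (patterns H x) S) :
    ∃ T : Finset X, NShatters H T ∧ T.card = S.card := by
  classical
  obtain ⟨f₀, f₁, hne, hsh⟩ := hS
  -- A repeated point would have to take the values `f₀` and `f₁` at once.
  have hinj : Set.InjOn x (S : Set (Fin n)) := by
    intro i hi j hj hij
    by_contra hne'
    obtain ⟨_, ⟨h, _, rfl⟩, h0, h1⟩ := hsh {i} (by simpa using hi)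
    obtain ⟨_, ⟨h', _, rfl⟩, h0', _⟩ := hsh {i, j}
      (by intro a; simp only [Finset.mem_insert, Finset.mem_singleton]
          rintro (rfl | rfl) <;> assumption)
    have a1 := h0 i (by simp)
    have a2 := h1 j hj (by simpa using Ne.symm hne')
    have b1 := h0' i (by simp)
    have b2 := h0' j (by simp)
    refine hne j hj ?_
    calc f₀ j = h' (x j) := b2.symm
      _ = h' (x i) := by rw [hij]
      _ = f₀ i := b1
      _ = h (x i) := a1.symm
      _ = h (x j) := by rw [hij]
      _ = f₁ j := a2
  refine ⟨S.image x, ?_, Finset.card_image_of_injOn hinj⟩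
  by_cases hn : Nonempty (Fin n)
  swap
  · obtain ⟨_, ⟨h, hh, _⟩, _⟩ := hsh ∅ (by simp)
    have : S = ∅ := Finset.eq_empty_of_forall_notMem fun i => absurd ⟨i⟩ hn
    exact ⟨h, h, by simp [this], fun R hR => ⟨h, hh, fun _ _ => rfl, fun _ _ _ => rfl⟩⟩
  have hleft : ∀ i ∈ S, Function.invFunOn x S (x i) = i := fun i hi =>
    Function.invFunOn_apply_eq (f := x) hi |> fun h =>
      hinj (Function.invFunOn_mem ⟨i, hi, rfl⟩) hi h
  refine ⟨f₀ ∘ Function.invFunOn x S, f₁ ∘ Function.invFunOn x S, ?_, ?_⟩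
  · intro a ha
    obtain ⟨i, hi, rfl⟩ := Finset.mem_image.1 ha
    simpa [hleft i hi] using hne i hi
  · intro R hR
    obtain ⟨_, ⟨h, hh, rfl⟩, h0, h1⟩ := hsh (S.filter fun i => x i ∈ R) (Finset.filter_subset _ _)
    refine ⟨h, hh, ?_, ?_⟩
    · intro a ha
      obtain ⟨i, hi, rfl⟩ := Finset.mem_image.1 (hR ha)
      simpa [hleft i hi] using h0 i (by simp [hi, ha])
    · intro a ha haR
      obtain ⟨i, hi, rfl⟩ := Finset.mem_image.1 ha
      simpa [hleft i hi] using h1 i hi (by simp [haR])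

theorem ncard_patterns_le {X Y : Type*} [Fintype Y] {n d : ℕ} {H : Set (X → Y)}
    (hH : natarajanDim H ≤ d) (x : Fin n → X) {t : ℝ} (ht : 0 < t) (ht1 : t ≤ 1) :
    ((patterns H x).ncard : ℝ) ≤ t⁻¹ ^ d * Real.exp (t * (Fintype.card Y : ℝ) ^ 2 * n) := by
  classical
  have hfin : (patterns H x).Finite := Set.toFinite _
  rw [Set.ncard_eq_toFinset_card _ hfin]
  refine (card_le_of_nshatters ht ht1 n d hfin.toFinset fun S hS => ?_).trans ?_
  · obtain ⟨T, hT, hTS⟩ := NShatters.of_patterns (by simpa using hS)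
    exact hTS ▸ natarajanDim_le_iff.1 hH T hT
  · gcongr
    rw [mul_comm _ (n : ℝ), Real.exp_nat_mul]
    gcongr
    rw [add_comm]
    exact Real.add_one_le_exp _

/-! ### Random signs -/

/-- The sign `±1` encoded by a Boolean. -/
def sgn (b : Bool) : ℝ := if b then 1 else -1

/-- The moment generating function of a random signed sum, as a sum over sign vectors. -/
theorem sum_exp_signs_le {m : ℕ} (a : Fin m → ℝ) :
    ∑ σ : Fin m → Bool, Real.exp (∑ i, sgn (σ i) * a i) ≤
      2 ^ m * Real.exp ((∑ i, a i ^ 2) / 2) := by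
  have h1 : ∑ σ : Fin m → Bool, Real.exp (∑ i, sgn (σ i) * a i) =
      ∏ i, ∑ b : Bool, Real.exp (sgn b * a i) := by
    rw [Finset.prod_univ_sum, Fintype.piFinset_univ]
    exact Finset.sum_congr rfl fun σ _ => Real.exp_sum _ _
  rw [h1, Finset.sum_div, Real.exp_sum]
  calc ∏ i, ∑ b : Bool, Real.exp (sgn b * a i)
      ≤ ∏ i : Fin m, 2 * Real.exp (a i ^ 2 / 2) := by
        refine Finset.prod_le_prod (fun i _ => by positivity) fun i _ => ?_
        have := Real.cosh_le_exp_half_sq (a i)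
        rw [Real.cosh_eq] at this
        simp only [Fintype.sum_bool, sgn, if_true, one_mul, Bool.false_eq_true, if_false,
          neg_mul]
        linarith
    _ = 2 ^ m * ∏ i, Real.exp (a i ^ 2 / 2) := by
        rw [Finset.prod_mul_distrib]; simp

theorem card_lt_signs_le {m : ℕ} (a : Fin m → ℝ) {s W : ℝ} (hs : 0 ≤ s) (hW : 0 < W)
    (ha : ∑ i, a i ^ 2 ≤ W) :
    ((Finset.univ.filter fun σ : Fin m → Bool => s < ∑ i, sgn (σ i) * a i).card : ℝ) ≤
      2 ^ m * Real.exp (-(s ^ 2 / (2 * W))) := by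
  -- The exponential Markov inequality at the optimal parameter `s / W`.
  have h1 := sum_exp_signs_le fun i => s / W * a i
  have h2 : ((Finset.univ.filter fun σ : Fin m → Bool =>
      s < ∑ i, sgn (σ i) * a i).card : ℝ) * Real.exp (s / W * s) ≤
      ∑ σ : Fin m → Bool, Real.exp (∑ i, sgn (σ i) * (s / W * a i)) := by
    rw [← nsmul_eq_mul, ← Finset.sum_const]
    refine (Finset.sum_le_sum fun σ hσ => ?_).trans
      (Finset.sum_le_sum_of_subset_of_nonneg (Finset.filter_subset _ _)
        fun _ _ _ => (Real.exp_pos _).le)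
    have hσ' := (Finset.mem_filter.1 hσ).2
    have h3 : ∑ i, sgn (σ i) * (s / W * a i) = s / W * ∑ i, sgn (σ i) * a i := by
      rw [Finset.mul_sum]
      exact Finset.sum_congr rfl fun i _ => by ring
    rw [h3]
    gcongr
  have h4 : (∑ i, (s / W * a i) ^ 2) / 2 ≤ s ^ 2 / (2 * W) := by
    have : ∑ i, (s / W * a i) ^ 2 = (s / W) ^ 2 * ∑ i, a i ^ 2 := by
      rw [Finset.mul_sum]
      exact Finset.sum_congr rfl fun i _ => by ring
    rw [this]
    calc (s / W) ^ 2 * (∑ i, a i ^ 2) / 2 ≤ (s / W) ^ 2 * W / 2 := by gcongr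
      _ = s ^ 2 / (2 * W) := by field_simp
  have h5 := (h2.trans h1).trans
    (mul_le_mul_of_nonneg_left (Real.exp_le_exp.2 h4) (by positivity))
  have h6 : Real.exp (s ^ 2 / (2 * W)) = Real.exp (-(s ^ 2 / (2 * W))) * Real.exp (s / W * s) := by
    rw [← Real.exp_add]
    congr 1
    field_simp
    ring
  rw [h6, ← mul_assoc] at h5
  exact le_of_mul_le_mul_right h5 (Real.exp_pos _)

/-- Hoeffding's inequality for random signs, as a count of sign vectors. -/
theorem card_lt_abs_signs_le {m : ℕ} (a : Fin m → ℝ) {s W : ℝ} (hs : 0 ≤ s) (hW : 0 < W)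
    (ha : ∑ i, a i ^ 2 ≤ W) :
    ((Finset.univ.filter fun σ : Fin m → Bool => s < |∑ i, sgn (σ i) * a i|).card : ℝ) ≤
      2 ^ m * (2 * Real.exp (-(s ^ 2 / (2 * W)))) := by
  have h1 := card_lt_signs_le a hs hW ha
  have h2 := card_lt_signs_le (fun i => -a i) hs hW (by simpa using ha)
  have h3 : (Finset.univ.filter fun σ : Fin m → Bool => s < |∑ i, sgn (σ i) * a i|) ⊆
      (Finset.univ.filter fun σ : Fin m → Bool => s < ∑ i, sgn (σ i) * a i) ∪
      (Finset.univ.filter fun σ : Fin m → Bool => s < ∑ i, sgn (σ i) * -a i) := by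
    intro σ
    simp [lt_abs]
  have h4 : ((Finset.univ.filter fun σ : Fin m → Bool =>
      s < |∑ i, sgn (σ i) * a i|).card : ℝ) ≤ _ :=
    Nat.cast_le.2 ((Finset.card_le_card h3).trans (Finset.card_union_le _ _))
  push_cast at h4
  linarith

/-! ### Packing numbers from growth -/

/-- A packing bound. A random choice of about `2 log |U| / α` coordinates separates all of `U` as
soon as its elements pairwise differ in more than a fraction `α` of the coordinates; hence `|U|` is
at most the growth function at that many coordinates. -/
theorem card_separated_le {β : Type*} [DecidableEq β] {m d : ℕ} {B α : ℝ} (hB : 1 ≤ B)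
    (hα : 0 < α) (hα1 : α ≤ 1) (U : Finset (Fin m → β))
    (hgrow : ∀ (M : ℕ) (I : Fin M → Fin m) (t : ℝ), 0 < t → t ≤ 1 →
      ((U.image fun u => u ∘ I).card : ℝ) ≤ t⁻¹ ^ d * Real.exp (t * (2 * B * M)))
    (hsep : ∀ u ∈ U, ∀ w ∈ U, u ≠ w → α * m < hammingDist u w) :
    (U.card : ℝ) ≤ Real.exp (1 / 2) * ((8 * B / α) ^ d) ^ 2 := by
  have hq : 1 ≤ 8 * B / α := by rw [le_div_iff₀ hα]; linarith
  have hr : 1 ≤ Real.exp (1 / 2) * ((8 * B / α) ^ d) ^ 2 := by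
    have h1 : 1 ≤ Real.exp (1 / 2) := Real.one_le_exp (by norm_num)
    have h2 : 1 ≤ ((8 * B / α) ^ d) ^ 2 := one_le_pow₀ (one_le_pow₀ hq)
    nlinarith
  rcases Nat.lt_or_ge 1 U.card with hU | hU
  swap
  · exact le_trans (by exact_mod_cast hU) hr
  have hm : 0 < m := by
    obtain ⟨u, _, w, _, huw⟩ := Finset.one_lt_card.1 hU
    rcases Nat.eq_zero_or_pos m with rfl | h
    · exact absurd (Subsingleton.elim u w) huw
    · exact h
  set N : ℝ := (U.card : ℝ) with hN
  have hN0 : 0 < N := by rw [hN]; exact_mod_cast (by omega : 0 < U.card)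
  set M : ℕ := ⌊2 * Real.log N / α⌋₊ + 1 with hM
  have hMα : 2 * Real.log N < α * M := by
    have := Nat.lt_floor_add_one (2 * Real.log N / α)
    rw [div_lt_iff₀ hα] at this
    rw [hM]; push_cast; linarith
  have hMα' : α * M ≤ 2 * Real.log N + α := by
    have hlog : 0 ≤ Real.log N := Real.log_nonneg (by rw [hN]; exact_mod_cast hU.le)
    have := Nat.floor_le (a := 2 * Real.log N / α) (by positivity)
    rw [le_div_iff₀ hα] at this
    rw [hM]; push_cast; linarith
  obtain ⟨I, hI⟩ : ∃ I : Fin M → Fin m, ∀ u ∈ U, ∀ w ∈ U, u ≠ w → u ∘ I ≠ w ∘ I := by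
    by_contra hcon
    push Not at hcon
    have hcover : (Finset.univ : Finset (Fin M → Fin m)) ⊆ U.offDiag.biUnion fun p =>
        Fintype.piFinset fun _ : Fin M => Finset.univ.filter fun i => p.1 i = p.2 i := by
      intro I _
      obtain ⟨u, hu, w, hw, huw, h⟩ := hcon I
      exact Finset.mem_biUnion.2 ⟨(u, w), Finset.mem_offDiag.2 ⟨hu, hw, huw⟩,
        Fintype.mem_piFinset.2 fun i => by simpa using congrFun h i⟩
    have h1 : (m : ℝ) ^ M ≤ ∑ p ∈ U.offDiag,
        ((Finset.univ.filter fun i : Fin m => p.1 i = p.2 i).card : ℝ) ^ M := by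
      have := (Finset.card_le_card hcover).trans Finset.card_biUnion_le
      simp only [Finset.card_univ, Fintype.card_fun, Fintype.card_fin,
        Fintype.card_piFinset_const] at this
      exact_mod_cast this
    have h2 : ∀ p ∈ U.offDiag,
        ((Finset.univ.filter fun i : Fin m => p.1 i = p.2 i).card : ℝ) ^ M ≤
          (m : ℝ) ^ M * Real.exp (-(α * M)) := by
      intro p hp
      obtain ⟨hp1, hp2, hne⟩ := Finset.mem_offDiag.1 hp
      have h3 := hsep _ hp1 _ hp2 hne
      have h4 : ((Finset.univ.filter fun i : Fin m => p.1 i = p.2 i).card : ℝ) +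
          hammingDist p.1 p.2 = m := by
        have := Finset.card_filter_add_card_filter_not (s := (Finset.univ : Finset (Fin m)))
          fun i => p.1 i = p.2 i
        rw [Finset.card_univ, Fintype.card_fin] at this
        exact_mod_cast this
      have h5 : ((Finset.univ.filter fun i : Fin m => p.1 i = p.2 i).card : ℝ) ≤
          m * Real.exp (-α) := by
        have := Real.add_one_le_exp (-α)
        have hm' : (0 : ℝ) ≤ m := by positivity
        nlinarith
      calc _ ≤ (m * Real.exp (-α)) ^ M := by gcongr
        _ = (m : ℝ) ^ M * Real.exp (-(α * M)) := by
          rw [mul_pow, ← Real.exp_nat_mul]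
          congr 2
          ring
    have h6 := h1.trans (Finset.sum_le_sum h2)
    rw [Finset.sum_const, nsmul_eq_mul] at h6
    have h7 : (U.offDiag.card : ℝ) ≤ N ^ 2 := by
      rw [Finset.offDiag_card, hN, sq]
      exact_mod_cast Nat.sub_le _ _
    have h8 : Real.exp (-(α * M)) < (N ^ 2)⁻¹ := by
      rw [← Real.exp_log (by positivity : 0 < (N ^ 2)⁻¹)]
      apply Real.exp_lt_exp.2
      rw [Real.log_inv, Real.log_pow]
      push_cast
      linarith
    have hmM : (0 : ℝ) < (m : ℝ) ^ M := by positivity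
    have h9 : (U.offDiag.card : ℝ) * ((m : ℝ) ^ M * Real.exp (-(α * M))) < (m : ℝ) ^ M := by
      calc _ ≤ N ^ 2 * ((m : ℝ) ^ M * Real.exp (-(α * M))) := by gcongr
        _ < N ^ 2 * ((m : ℝ) ^ M * (N ^ 2)⁻¹) := by gcongr
        _ = (m : ℝ) ^ M := by field_simp
    linarith
  have hcard : (U.image fun u => u ∘ I).card = U.card :=
    Finset.card_image_of_injOn fun u hu w hw h => by
      by_contra hne
      exact hI u hu w hw hne h
  -- With this `t` the exponential factor is at most about `√N`, so it can be absorbed.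
  have h1 := hgrow M I (α / (8 * B)) (by positivity) (by rw [div_le_one (by positivity)]; linarith)
  rw [hcard, ← hN, inv_div] at h1
  have h2 : α / (8 * B) * (2 * B * M) ≤ Real.log N / 2 + 1 / 4 := by
    have : α / (8 * B) * (2 * B * M) = α * M / 4 := by field_simp; ring
    rw [this]; linarith
  have h3 : N ≤ (8 * B / α) ^ d * Real.exp (Real.log N / 2 + 1 / 4) :=
    h1.trans (by gcongr)
  have h4 : N = Real.exp (Real.log N / 2) ^ 2 := by
    rw [← Real.exp_nat_mul]
    conv_lhs => rw [← Real.exp_log hN0]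
    congr 1
    push_cast
    ring
  have h5 : Real.exp (1 / 2) = Real.exp (1 / 4) ^ 2 := by
    rw [← Real.exp_nat_mul]
    congr 1
    norm_num
  rw [Real.exp_add] at h3
  set r := Real.exp (Real.log N / 2) with hr'
  have hr0 : 0 < r := Real.exp_pos _
  have h6 : r ≤ (8 * B / α) ^ d * Real.exp (1 / 4) := by
    have : r * r ≤ (8 * B / α) ^ d * Real.exp (1 / 4) * r := by
      calc r * r = N := by rw [h4, sq]
        _ ≤ _ := h3
        _ = _ := by ring
    exact le_of_mul_le_mul_right this hr0
  calc N = r ^ 2 := h4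
    _ ≤ ((8 * B / α) ^ d * Real.exp (1 / 4)) ^ 2 := by gcongr
    _ = _ := by rw [h5]; ring

/-! ### Chaining -/

/-- A maximal separated subset is a net. -/
theorem exists_separated_net {β : Type*} [DecidableEq β] {m : ℕ} (T : Finset (Fin m → β))
    {r : ℝ} (hr : 0 ≤ r) :
    ∃ U ⊆ T, (∀ u ∈ U, ∀ w ∈ U, u ≠ w → r < hammingDist u w) ∧
      ∀ v ∈ T, ∃ u ∈ U, (hammingDist v u : ℝ) ≤ r := by
  classical
  obtain ⟨U, hU, hmax⟩ := Finset.exists_max_image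
    (T.powerset.filter fun U => ∀ u ∈ U, ∀ w ∈ U, u ≠ w → r < hammingDist u w) Finset.card
    ⟨∅, by simp⟩
  obtain ⟨hUT, hsep⟩ := Finset.mem_filter.1 hU
  refine ⟨U, Finset.mem_powerset.1 hUT, hsep, fun v hv => ?_⟩
  by_contra! hfar
  have hvU : v ∉ U := fun h => by
    have := hfar v h
    simp at this
    linarith
  have := hmax (insert v U) (Finset.mem_filter.2 ⟨Finset.mem_powerset.2
    (Finset.insert_subset hv (Finset.mem_powerset.1 hUT)), ?_⟩)
  · rw [Finset.card_insert_of_notMem hvU] at this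
    omega
  · intro u hu w hw huw
    rcases Finset.mem_insert.1 hu with rfl | hu' <;> rcases Finset.mem_insert.1 hw with rfl | hw'
    · exact absurd rfl huw
    · exact hfar w hw'
    · rw [hammingDist_comm]
      exact hfar u hu'
    · exact hsep u hu' w hw' huw

/-- Chaining. Along nets of radius `4⁻ʲ m` the links at level `j` exceed `τ (3/4)ʲ` with small
probability; these thresholds sum to at most `4 τ`. -/
theorem card_chaining_le {m : ℕ} (hm : 0 < m) (T : Finset (Fin m → ℝ))
    (hT : ∀ v ∈ T, ∀ i, |v i| ≤ 1) {τ q : ℝ} (hτ : 0 ≤ τ) (hq : 0 ≤ q) (K : ℕ → ℝ)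
    (hK : ∀ j, ∀ U ⊆ T,
      (∀ u ∈ U, ∀ w ∈ U, u ≠ w → (4 ^ j : ℝ)⁻¹ * m < hammingDist u w) → (U.card : ℝ) ≤ K j)
    (hKq : ∀ j, 2 * K j * Real.exp (-(τ ^ 2 / (32 * m) * (9 / 4) ^ j)) ≤ q * (1 / 2) ^ (j + 1)) :
    ((Finset.univ.filter fun σ : Fin m → Bool =>
      ∃ v ∈ T, 4 * τ < |∑ i, sgn (σ i) * v i|).card : ℝ) ≤ 2 ^ m * q := by
  classical
  have hm' : (0 : ℝ) < m := by exact_mod_cast hm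
  choose N hNT hNsep hNnet using fun j : ℕ =>
    exists_separated_net T (r := (4 ^ j : ℝ)⁻¹ * m) (by positivity)
  -- The predecessor of a net point; at level `0` it is the zero vector.
  have hpred : ∀ (j : ℕ) (v : Fin m → ℝ), ∃ w : Fin m → ℝ, v ∈ N j →
      ∑ i, (v i - w i) ^ 2 ≤ 16 * (4 ^ j : ℝ)⁻¹ * m ∧
      ((j = 0 ∧ w = 0) ∨ ∃ j', j = j' + 1 ∧ w ∈ N j') := by
    intro j v
    by_cases hv : v ∈ N j
    swap
    · exact ⟨0, fun h => absurd h hv⟩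
    rcases j with _ | j
    · refine ⟨0, fun _ => ⟨?_, Or.inl ⟨rfl, rfl⟩⟩⟩
      calc ∑ i, (v i - (0 : Fin m → ℝ) i) ^ 2 ≤ ∑ _i : Fin m, (1 : ℝ) := by
            refine Finset.sum_le_sum fun i _ => ?_
            have := hT v (hNT 0 hv) i
            simpa using this
        _ ≤ _ := by simp; linarith
    · obtain ⟨w, hw, hvw⟩ := hNnet j v (hNT _ hv)
      refine ⟨w, fun _ => ⟨?_, Or.inr ⟨j, rfl, hw⟩⟩⟩
      calc ∑ i, (v i - w i) ^ 2 ≤ ∑ i, (if v i ≠ w i then (4 : ℝ) else 0) := by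
            refine Finset.sum_le_sum fun i _ => ?_
            split_ifs with h
            · have h1 := abs_le.1 (hT v (hNT _ hv) i)
              have h2 := abs_le.1 (hT w (hNT _ hw) i)
              nlinarith
            · simp only [not_not] at h
              simp [h]
        _ = 4 * hammingDist v w := by
            rw [← Finset.sum_filter, Finset.sum_const, nsmul_eq_mul, mul_comm]
            rfl
        _ ≤ 4 * ((4 ^ j : ℝ)⁻¹ * m) := by gcongr
        _ = _ := by rw [pow_succ, mul_inv]; ring
  choose p hp using hpred
  set Bad : ℕ → Finset (Fin m → Bool) := fun j => (N j).biUnion fun v =>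
    Finset.univ.filter fun σ => τ * (3 / 4) ^ j < |∑ i, sgn (σ i) * (v i - p j v i)| with hBad
  have hBadcard : ∀ j, ((Bad j).card : ℝ) ≤ 2 ^ m * (q * (1 / 2) ^ (j + 1)) := by
    intro j
    have h1 : ((Bad j).card : ℝ) ≤ ∑ v ∈ N j,
        (2 : ℝ) ^ m * (2 * Real.exp (-(τ ^ 2 / (32 * m) * (9 / 4) ^ j))) := by
      refine le_trans (Nat.cast_le.2 Finset.card_biUnion_le) ?_
      push_cast
      refine Finset.sum_le_sum fun v hv => ?_
      refine (card_lt_abs_signs_le (fun i => v i - p j v i) (by positivity)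
        (W := 16 * (4 ^ j : ℝ)⁻¹ * m) (by positivity) (hp j v hv).1).trans (le_of_eq ?_)
      congr 4
      have e1 : ((9 : ℝ) / 4) ^ j = ((3 / 4) ^ j) ^ 2 * 4 ^ j := by
        rw [← pow_mul, mul_comm j 2, pow_mul, ← mul_pow]; norm_num
      rw [e1]
      field_simp
      ring
    rw [Finset.sum_const, nsmul_eq_mul] at h1
    calc ((Bad j).card : ℝ) ≤ _ := h1
      _ = 2 ^ m * (2 * (N j).card * Real.exp (-(τ ^ 2 / (32 * m) * (9 / 4) ^ j))) := by ring
      _ ≤ 2 ^ m * (2 * K j * Real.exp (-(τ ^ 2 / (32 * m) * (9 / 4) ^ j))) := by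
          gcongr
          exact hK j _ (hNT j) (hNsep j)
      _ ≤ _ := mul_le_mul_of_nonneg_left (hKq j) (by positivity)
  have hgood : ∀ (σ : Fin m → Bool) (j : ℕ), (∀ i ≤ j, σ ∉ Bad i) → ∀ v ∈ N j,
      |∑ i, sgn (σ i) * v i| ≤ 4 * τ * (1 - (3 / 4) ^ (j + 1)) := by
    intro σ j
    induction j with
    | zero =>
      intro hσ v hv
      have h1 : |∑ i, sgn (σ i) * (v i - p 0 v i)| ≤ τ * (3 / 4) ^ 0 := by
        by_contra! h
        exact hσ 0 le_rfl (Finset.mem_biUnion.2 ⟨v, hv, by simpa using h⟩)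
      obtain ⟨_, hp0⟩ | ⟨j', h, _⟩ := (hp 0 v hv).2
      · rw [hp0] at h1
        simp only [Pi.zero_apply, sub_zero] at h1
        linarith
      · omega
    | succ j ih =>
      intro hσ v hv
      have h1 : |∑ i, sgn (σ i) * (v i - p (j + 1) v i)| ≤ τ * (3 / 4) ^ (j + 1) := by
        by_contra! h
        exact hσ (j + 1) le_rfl (Finset.mem_biUnion.2 ⟨v, hv, by simpa using h⟩)
      obtain ⟨h, _⟩ | ⟨j', h, hw⟩ := (hp (j + 1) v hv).2
      · omega
      · obtain rfl : j = j' := by omega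
        have h2 := ih (fun i hi => hσ i (by omega)) _ hw
        have h3 : ∑ i, sgn (σ i) * v i =
            ∑ i, sgn (σ i) * (v i - p (j + 1) v i) + ∑ i, sgn (σ i) * p (j + 1) v i := by
          rw [← Finset.sum_add_distrib]
          exact Finset.sum_congr rfl fun i _ => by ring
        rw [h3]
        refine (abs_add_le _ _).trans ((add_le_add h1 h2).trans (le_of_eq ?_))
        ring
  -- At a level `J` with `4⁻ᴶ m < 1` the net is all of `T`.
  obtain ⟨J, hJ⟩ : ∃ J : ℕ, (m : ℝ) < 4 ^ J := pow_unbounded_of_one_lt _ (by norm_num)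
  have hTN : T ⊆ N J := by
    intro v hv
    obtain ⟨u, hu, hvu⟩ := hNnet J v hv
    have : (hammingDist v u : ℝ) < 1 := by
      refine hvu.trans_lt ?_
      rw [inv_mul_lt_iff₀ (by positivity)]
      linarith
    have : v = u := hammingDist_lt_one.1 (by exact_mod_cast this)
    exact this ▸ hu
  have hsub : (Finset.univ.filter fun σ : Fin m → Bool =>
      ∃ v ∈ T, 4 * τ < |∑ i, sgn (σ i) * v i|) ⊆ (Finset.range (J + 1)).biUnion Bad := by
    intro σ hσ
    obtain ⟨v, hv, hlt⟩ := (Finset.mem_filter.1 hσ).2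
    by_contra hcon
    have h1 := hgood σ J (fun i hi h => hcon (Finset.mem_biUnion.2
      ⟨i, Finset.mem_range.2 (by omega), h⟩)) v (hTN hv)
    have h2 : 0 ≤ 4 * τ * (3 / 4) ^ (J + 1) := by positivity
    linarith
  calc _ ≤ (((Finset.range (J + 1)).biUnion Bad).card : ℝ) :=
        Nat.cast_le.2 (Finset.card_le_card hsub)
    _ ≤ ∑ j ∈ Finset.range (J + 1), ((Bad j).card : ℝ) := by
        exact_mod_cast Finset.card_biUnion_le
    _ ≤ ∑ j ∈ Finset.range (J + 1), 2 ^ m * (q * (1 / 2) ^ (j + 1)) :=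
        Finset.sum_le_sum fun j _ => hBadcard j
    _ = 2 ^ m * (q * (1 - (1 / 2) ^ (J + 1))) := by
        rw [← Finset.mul_sum, ← Finset.mul_sum]
        congr 2
        simp only [pow_succ (1 / 2 : ℝ), ← Finset.sum_mul]
        rw [geom_sum_eq (by norm_num)]
        ring
    _ ≤ 2 ^ m * q := by
        have : q * (1 - (1 / 2) ^ (J + 1)) ≤ q := by
          have : 0 ≤ q * (1 / 2) ^ (J + 1) := by positivity
          linarith
        gcongr

/-! ### Symmetrization -/

/-- The sample that takes its `i`-th entry from `S` or from `S'` according to `σ i`. -/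
def mix {Z : Type*} {m : ℕ} (σ : Fin m → Bool) (S S' : Fin m → Z) : Fin m → Z :=
  fun i => if σ i then S i else S' i

theorem mix_mix {Z : Type*} {m : ℕ} (σ : Fin m → Bool) (S S' : Fin m → Z) :
    mix σ (mix σ S S') (mix σ S' S) = S := by
  funext i
  simp only [mix]
  split_ifs <;> rfl

/-- Exchanging the entries of a sample and of a ghost sample at the indices with `σ i = false`. -/
def mixEquiv {Z : Type*} {m : ℕ} (σ : Fin m → Bool) :
    (Fin m → Z) × (Fin m → Z) ≃ (Fin m → Z) × (Fin m → Z) where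
  toFun p := (mix σ p.1 p.2, mix σ p.2 p.1)
  invFun p := (mix σ p.1 p.2, mix σ p.2 p.1)
  left_inv p := by simp [mix_mix]
  right_inv p := by simp [mix_mix]

theorem iid_mix_mul {Z : Type*} (P : PMF Z) {m : ℕ} (σ : Fin m → Bool) (S S' : Fin m → Z) :
    iid P m (mix σ S S') * iid P m (mix σ S' S) = iid P m S * iid P m S' := by
  simp only [iid_apply, ← Finset.prod_mul_distrib]
  refine Finset.prod_congr rfl fun i _ => ?_
  simp only [mix]
  split_ifs
  · rfl
  · exact mul_comm _ _

/-- Symmetrization with a ghost sample. If every bad sample is in relation `E` with at least half of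
all ghost samples, and for fixed samples at most a fraction `q` of all exchanges produces the
relation `E`, then bad samples have probability at most `2 q`. -/
theorem toOuterMeasure_le_of_symmetrization {Z : Type*} (P : PMF Z) {m : ℕ}
    (bad : Set (Fin m → Z)) (E : (Fin m → Z) → (Fin m → Z) → Prop) {q : ℝ}
    (hghost : ∀ S ∈ bad, (iid P m).toOuterMeasure {S' | E S S'}ᶜ ≤ ENNReal.ofReal (1 / 2))
    (hsign : ∀ S S' : Fin m → Z,
      (({σ : Fin m → Bool | E (mix σ S S') (mix σ S' S)}.ncard : ℕ) : ℝ) ≤ 2 ^ m * q) :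
    (iid P m).toOuterMeasure bad ≤ ENNReal.ofReal (2 * q) := by
  classical
  set w := iid P m with hw
  set f : (Fin m → Z) × (Fin m → Z) → ℝ≥0∞ := fun p =>
    w p.1 * w p.2 * (if E p.1 p.2 then 1 else 0) with hf
  have hhalf : ENNReal.ofReal (1 - 1 / 2) = 2⁻¹ := by
    rw [show (1 : ℝ) - 1 / 2 = 2⁻¹ by norm_num, ENNReal.ofReal_inv_of_pos (by norm_num)]
    simp
  have h1 : 2⁻¹ * w.toOuterMeasure bad ≤ ∑' p, f p := by
    rw [ENNReal.tsum_prod', PMF.toOuterMeasure_apply, ← ENNReal.tsum_mul_left]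
    refine ENNReal.tsum_le_tsum fun S => ?_
    by_cases hS : S ∈ bad
    swap
    · simp [hS]
    have h2 := ofReal_one_sub_le_toOuterMeasure w (by norm_num) (hghost S hS)
    rw [hhalf, PMF.toOuterMeasure_apply] at h2
    rw [Set.indicator_of_mem hS]
    calc 2⁻¹ * w S ≤ (∑' S', {S' | E S S'}.indicator w S') * w S := by gcongr
      _ = ∑' S', f (S, S') := by
        rw [mul_comm, ← ENNReal.tsum_mul_left]
        refine tsum_congr fun S' => ?_
        by_cases hE : E S S' <;> simp [hf, hE]
  have h2 : (2 : ℝ≥0∞) ^ m * ∑' p, f p ≤ 2 ^ m * ENNReal.ofReal q := by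
    calc (2 : ℝ≥0∞) ^ m * ∑' p, f p = ∑ σ : Fin m → Bool, ∑' p, f (mixEquiv σ p) := by
          simp only [(mixEquiv _).tsum_eq]
          simp
      _ = ∑' p, ∑ σ : Fin m → Bool, f (mixEquiv σ p) := by
          rw [Summable.tsum_finsetSum fun _ _ => ENNReal.summable]
      _ ≤ ∑' p : (Fin m → Z) × (Fin m → Z), w p.1 * w p.2 * (2 ^ m * ENNReal.ofReal q) := by
          refine ENNReal.tsum_le_tsum fun p => ?_
          have h3 : ∀ σ : Fin m → Bool, f (mixEquiv σ p) = w p.1 * w p.2 *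
              (if E (mix σ p.1 p.2) (mix σ p.2 p.1) then 1 else 0) := fun σ => by
            simp only [hf, mixEquiv, Equiv.coe_fn_mk, hw, iid_mix_mul]
          simp only [h3]
          rw [← Finset.mul_sum, Finset.sum_boole]
          gcongr
          have h4 := ENNReal.ofReal_le_ofReal (hsign p.1 p.2)
          rw [Set.ncard_eq_toFinset_card', ENNReal.ofReal_natCast,
            ENNReal.ofReal_mul (by positivity), ENNReal.ofReal_pow (by norm_num)] at h4
          simpa using h4
      _ = 2 ^ m * ENNReal.ofReal q := by
          rw [ENNReal.tsum_mul_right, ENNReal.tsum_prod']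
          simp [ENNReal.tsum_mul_left]
  have h3 : ∑' p, f p ≤ ENNReal.ofReal q :=
    (ENNReal.mul_le_mul_iff_right (by simp) (by simp)).1 h2
  calc w.toOuterMeasure bad = 2 * (2⁻¹ * w.toOuterMeasure bad) := by
        rw [← mul_assoc, ENNReal.mul_inv_cancel (by simp) (by simp), one_mul]
    _ ≤ 2 * ENNReal.ofReal q := by gcongr; exact h1.trans h3
    _ = ENNReal.ofReal (2 * q) := by rw [ENNReal.ofReal_mul (by norm_num)]; simp

/-! ### Deviations for a fixed hypothesis -/

/-- The number of entries of `S` in `A`. -/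
def count {Z : Type*} {m : ℕ} (A : Set Z) (S : Fin m → Z) : ℕ := {i | S i ∈ A}.ncard

theorem count_eq_sum {Z : Type*} {m : ℕ} (A : Set Z) (S : Fin m → Z) :
    (count A S : ℝ) = ∑ i, A.indicator (fun _ => (1 : ℝ)) (S i) := by
  classical
  rw [count, Set.ncard_eq_toFinset_card']
  simp [Set.indicator_apply]

/-- The exponential Markov inequality for the number of draws that fall in `A`. -/
theorem toOuterMeasure_le_of_exp {Z : Type*} (P : PMF Z) (A : Set Z) {m : ℕ} (x y c : ℝ)
    (B : Set (Fin m → Z)) (hB : ∀ S ∈ B, c ≤ x * count A S + y * m) :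
    (iid P m).toOuterMeasure B ≤ ENNReal.ofReal (Real.exp (-c) *
      ((P.toOuterMeasure A).toReal * Real.exp (x + y) +
        (1 - (P.toOuterMeasure A).toReal) * Real.exp y) ^ m) := by
  classical
  set F : Z → ℝ≥0∞ := fun z =>
    ENNReal.ofReal (Real.exp (x * A.indicator (fun _ => (1 : ℝ)) z + y)) with hF
  have hcompl : P.toOuterMeasure A + P.toOuterMeasure Aᶜ = 1 := by
    simp only [PMF.toOuterMeasure_apply]
    rw [← ENNReal.tsum_add, ← P.tsum_coe]
    exact tsum_congr fun z => by by_cases hz : z ∈ A <;> simp [hz]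
  have hA : P.toOuterMeasure A ≤ 1 := hcompl ▸ le_self_add
  set p := (P.toOuterMeasure A).toReal with hp
  have hp1 : p ≤ 1 := ENNReal.toReal_le_of_le_ofReal zero_le_one (by simpa using hA)
  have hA' : P.toOuterMeasure A = ENNReal.ofReal p :=
    (ENNReal.ofReal_toReal (hA.trans_lt ENNReal.one_lt_top).ne).symm
  have hAc : P.toOuterMeasure Aᶜ = ENNReal.ofReal (1 - p) := by
    rw [ENNReal.ofReal_sub _ ENNReal.toReal_nonneg, ← hA', ENNReal.ofReal_one, ← hcompl]
    exact (ENNReal.add_sub_cancel_left (hA.trans_lt ENNReal.one_lt_top).ne).symm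
  have hsum : ∑' z, P z * F z =
      ENNReal.ofReal (p * Real.exp (x + y) + (1 - p) * Real.exp y) := by
    rw [ENNReal.ofReal_add (mul_nonneg ENNReal.toReal_nonneg (Real.exp_pos _).le)
      (mul_nonneg (by linarith) (Real.exp_pos _).le), ENNReal.ofReal_mul ENNReal.toReal_nonneg,
      ENNReal.ofReal_mul (by linarith), ← hA', ← hAc, PMF.toOuterMeasure_apply,
      PMF.toOuterMeasure_apply, ← ENNReal.tsum_mul_right, ← ENNReal.tsum_mul_right,
      ← ENNReal.tsum_add]
    exact tsum_congr fun z => by by_cases hz : z ∈ A <;> simp [hz, hF]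
  have hprod : ∀ S : Fin m → Z, ∏ i, F (S i) =
      ENNReal.ofReal (Real.exp (x * count A S + y * m)) := by
    intro S
    rw [← ENNReal.ofReal_prod_of_nonneg fun _ _ => (Real.exp_pos _).le, ← Real.exp_sum,
      Finset.sum_add_distrib, ← Finset.mul_sum, ← count_eq_sum]
    simp [mul_comm]
  calc (iid P m).toOuterMeasure B
      ≤ ∑' S : Fin m → Z, ENNReal.ofReal (Real.exp (-c)) * ∏ i, (P (S i) * F (S i)) := by
        rw [PMF.toOuterMeasure_apply]
        refine ENNReal.tsum_le_tsum fun S => ?_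
        by_cases hS : S ∈ B
        · rw [Set.indicator_of_mem hS, Finset.prod_mul_distrib, hprod, ← iid_apply, mul_left_comm,
            ← ENNReal.ofReal_mul (Real.exp_pos _).le, ← Real.exp_add]
          refine le_mul_of_one_le_right' ?_
          rw [ENNReal.one_le_ofReal]
          exact Real.one_le_exp (by linarith [hB S hS])
        · simp [hS]
    _ = _ := by
        rw [ENNReal.tsum_mul_left, tsum_pi_prod fun _ z => P z * F z, hsum,
          ENNReal.ofReal_mul (Real.exp_pos _).le, ENNReal.ofReal_pow]
        · simp
        · exact add_nonneg (mul_nonneg ENNReal.toReal_nonneg (Real.exp_pos _).le)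
            (mul_nonneg (by linarith) (Real.exp_pos _).le)

theorem toReal_toOuterMeasure_le_one {Z : Type*} (P : PMF Z) (A : Set Z) :
    (P.toOuterMeasure A).toReal ≤ 1 := by
  refine ENNReal.toReal_le_of_le_ofReal zero_le_one ?_
  rw [ENNReal.ofReal_one, ← (P.toOuterMeasure_apply_eq_one_iff Set.univ).2 (Set.subset_univ _)]
  exact MeasureTheory.measure_mono (Set.subset_univ _)

/-- An event of probability at least `ε` is seen at least `ε m / 2` times, with probability at
least `1 / 2`. -/
theorem toOuterMeasure_count_lt_le {Z : Type*} (P : PMF Z) (A : Set Z) {m : ℕ} {ε : ℝ}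
    (hA : ε ≤ (P.toOuterMeasure A).toReal) (hm : 6 ≤ ε * m) :
    (iid P m).toOuterMeasure {S | ε * m / 2 ≤ count A S}ᶜ ≤ ENNReal.ofReal (1 / 2) := by
  refine (toOuterMeasure_le_of_exp P A (-1) 0 (-(ε * m / 2)) _ fun S hS => ?_).trans
    (ENNReal.ofReal_le_ofReal ?_)
  · have : (count A S : ℝ) < ε * m / 2 := by simpa using hS
    linarith
  set p := (P.toOuterMeasure A).toReal
  have hp1 : p ≤ 1 := toReal_toOuterMeasure_le_one P A
  have hp0 : 0 ≤ p := ENNReal.toReal_nonneg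
  have he : Real.exp (-1) ≤ 0.368 := by
    have := Real.exp_neg_one_lt_d9
    linarith
  have hm0 : (0 : ℝ) ≤ m := by positivity
  rw [neg_neg, add_zero, Real.exp_zero, mul_one]
  have hb : p * Real.exp (-1) + (1 - p) ≤ Real.exp (-(0.632 * p)) := by
    have := Real.add_one_le_exp (-(0.632 * p))
    nlinarith
  have hb0 : 0 ≤ p * Real.exp (-1) + (1 - p) := by
    have := Real.exp_pos (-1)
    nlinarith
  calc Real.exp (ε * m / 2) * (p * Real.exp (-1) + (1 - p)) ^ m
      ≤ Real.exp (ε * m / 2) * Real.exp (-(0.632 * p)) ^ m := by gcongr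
    _ = Real.exp (ε * m / 2 - 0.632 * (p * m)) := by
        rw [← Real.exp_nat_mul, ← Real.exp_add]
        congr 1
        ring
    _ ≤ Real.exp (-Real.log 2) := by
        have := Real.log_two_lt_d9
        have h1 : ε * m ≤ p * m := by gcongr
        gcongr
        linarith
    _ = 1 / 2 := by rw [Real.exp_neg, Real.exp_log (by norm_num)]; norm_num

/-- The moment generating function of a centred Bernoulli variable of mean `p`, near `0`. -/
theorem exp_mean_le {p x : ℝ} (hp0 : 0 ≤ p) (hp1 : p ≤ 1) (hx : |x| ≤ 1) :
    p * Real.exp (x + -x * p) + (1 - p) * Real.exp (-x * p) ≤ Real.exp (x ^ 2) := by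
  have hx' := abs_le.1 hx
  have bound : ∀ y : ℝ, |y| ≤ 1 → Real.exp y ≤ 1 + y + y ^ 2 := fun y hy => by
    have := (abs_le.1 (Real.abs_exp_sub_one_sub_id_le hy)).2
    linarith
  have h1 := bound (x + -x * p) (by
    rw [show x + -x * p = x * (1 - p) by ring, abs_mul, abs_of_nonneg (by linarith : 0 ≤ 1 - p)]
    nlinarith [abs_nonneg x])
  have h2 := bound (-x * p) (by
    rw [abs_mul, abs_neg, abs_of_nonneg hp0]
    nlinarith [abs_nonneg x])
  have h3 := Real.add_one_le_exp (x ^ 2)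
  calc p * Real.exp (x + -x * p) + (1 - p) * Real.exp (-x * p)
      ≤ p * (1 + (x + -x * p) + (x + -x * p) ^ 2) +
        (1 - p) * (1 + (-x * p) + (-x * p) ^ 2) := by
        gcongr
    _ = 1 + x ^ 2 * (p * (1 - p)) := by ring
    _ ≤ 1 + x ^ 2 * 1 := by gcongr; nlinarith
    _ ≤ _ := by linarith

/-- The empirical frequency of an event is within `ε` of its probability, with probability at least
`1 / 2`. -/
theorem toOuterMeasure_lt_abs_count_sub_le {Z : Type*} (P : PMF Z) (A : Set Z) {m : ℕ} {ε : ℝ}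
    (hε0 : 0 < ε) (hε1 : ε ≤ 1) (hm : 6 ≤ ε ^ 2 * m) :
    (iid P m).toOuterMeasure
      {S | |(count A S : ℝ) - (P.toOuterMeasure A).toReal * m| ≤ ε * m}ᶜ ≤
      ENNReal.ofReal (1 / 2) := by
  set p := (P.toOuterMeasure A).toReal with hp
  have hp1 : p ≤ 1 := toReal_toOuterMeasure_le_one P A
  have hp0 : 0 ≤ p := ENNReal.toReal_nonneg
  have hm0 : (0 : ℝ) ≤ m := by positivity
  have one_side : ∀ x : ℝ, |x| = ε / 2 → ∀ B : Set (Fin m → Z),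
      (∀ S ∈ B, ε ^ 2 * m / 2 ≤ x * ((count A S : ℝ) - p * m)) →
      (iid P m).toOuterMeasure B ≤ ENNReal.ofReal (1 / 4) := by
    intro x hx B hB
    refine (toOuterMeasure_le_of_exp P A x (-x * p) (ε ^ 2 * m / 2) B
      fun S hS => (hB S hS).trans (le_of_eq (by ring))).trans (ENNReal.ofReal_le_ofReal ?_)
    have hmean := exp_mean_le hp0 hp1 (x := x) (by rw [hx]; linarith)
    have hx2 : x ^ 2 = ε ^ 2 / 4 := by rw [← sq_abs, hx]; ring
    have hn : 0 ≤ p * Real.exp (x + -x * p) + (1 - p) * Real.exp (-x * p) :=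
      add_nonneg (mul_nonneg hp0 (Real.exp_pos _).le)
        (mul_nonneg (by linarith) (Real.exp_pos _).le)
    calc _ ≤ Real.exp (-(ε ^ 2 * m / 2)) * Real.exp (x ^ 2) ^ m := by gcongr
      _ = Real.exp (-(ε ^ 2 * m / 4)) := by
        rw [← Real.exp_nat_mul, ← Real.exp_add, hx2]
        congr 1
        ring
      _ ≤ Real.exp (-(2 * Real.log 2)) := by
        have := Real.log_two_lt_d9
        gcongr
        linarith
      _ = 1 / 4 := by
        rw [two_mul, ← Real.log_mul (by norm_num) (by norm_num), Real.exp_neg,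
          Real.exp_log (by norm_num)]
        norm_num
  have hup := one_side (ε / 2) (abs_of_pos (by linarith))
    {S | ε * m ≤ (count A S : ℝ) - p * m} fun S hS => by
      have : ε * m ≤ (count A S : ℝ) - p * m := hS
      nlinarith
  have hlow := one_side (-(ε / 2)) (by rw [abs_neg, abs_of_pos (by linarith)])
    {S | (count A S : ℝ) - p * m ≤ -(ε * m)} fun S hS => by
      have : (count A S : ℝ) - p * m ≤ -(ε * m) := hS
      nlinarith
  refine (MeasureTheory.measure_mono (t := {S | ε * m ≤ (count A S : ℝ) - p * m} ∪
    {S | (count A S : ℝ) - p * m ≤ -(ε * m)}) fun S hS => ?_).trans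
    ((MeasureTheory.measure_union_le _ _).trans ((add_le_add hup hlow).trans (le_of_eq ?_)))
  · have : ε * m < |(count A S : ℝ) - p * m| := by simpa using hS
    rcases lt_abs.1 this with h | h
    · exact Or.inl h.le
    · exact Or.inr (by simp only [Set.mem_ofPred_eq]; linarith)
  · rw [← ENNReal.ofReal_add (by norm_num) (by norm_num)]
    norm_num

/-! ### Patterns of losses -/

/-- The labelled points on which `g` errs. -/
def mistakes {X Y : Type*} (g : X → Y) : Set (X × Y) := {z | g z.1 ≠ z.2}

/-- The growth bound for a quantity that depends on `h` only through the values of `h` along two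
samples of size `n`. -/
theorem ncard_image_le {X Y β : Type*} [Fintype Y] {n d : ℕ} {H : Set (X → Y)}
    (hH : natarajanDim H ≤ d) (Φ : (X → Y) → β) (S S' : Fin n → X × Y)
    (hΦ : ∀ h h' : X → Y, (∀ i, h (S i).1 = h' (S i).1) → (∀ i, h (S' i).1 = h' (S' i).1) →
      Φ h = Φ h') {t : ℝ} (ht : 0 < t) (ht1 : t ≤ 1) :
    (Φ '' H).Finite ∧ ((Φ '' H).ncard : ℝ) ≤
      t⁻¹ ^ d * Real.exp (t * (2 * (Fintype.card Y : ℝ) ^ 2 * n)) := by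
  rcases H.eq_empty_or_nonempty with rfl | ⟨h₀, _⟩
  · simp only [Set.image_empty, Set.finite_empty, Set.ncard_empty, true_and, Nat.cast_zero]
    positivity
  have : Nonempty β := ⟨Φ h₀⟩
  set x : Fin (n + n) → X := Fin.append (fun i => (S i).1) fun i => (S' i).1 with hx
  obtain ⟨Ψ, hΨ⟩ : ∃ Ψ : (Fin (n + n) → Y) → β, Φ = Ψ ∘ fun h i => h (x i) :=
    (Function.factorsThrough_iff Φ).1 fun h h' hh => hΦ h h'
      (fun i => by simpa [hx] using congrFun hh (Fin.castAdd n i))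
      (fun i => by simpa only [hx, Fin.append_right] using congrFun hh (Fin.natAdd n i))
  have himage : Φ '' H = Ψ '' patterns H x := by
    rw [hΨ, Set.image_comp]
    rfl
  have hfin : (patterns H x).Finite := Set.toFinite _
  rw [himage]
  refine ⟨hfin.image _, (Nat.cast_le.2 (Set.ncard_image_le hfin)).trans
    ((ncard_patterns_le hH x ht ht1).trans (le_of_eq ?_))⟩
  congr 2
  push_cast
  ring

theorem subsingleton_of_natarajanDim_le_zero {X Y : Type*} {H : Set (X → Y)}
    (hH : natarajanDim H ≤ (0 : ℕ)) : H.Subsingleton := by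
  classical
  intro h hh h' hh'
  by_contra hne
  obtain ⟨x, hx⟩ := Function.ne_iff.1 hne
  have := natarajanDim_le_iff.1 hH {x} ⟨h, h', by simpa using hx, fun R hR => ?_⟩
  · simp at this
  · rcases Finset.subset_singleton_iff.1 hR with rfl | rfl
    · exact ⟨h', hh', by simp, by simp⟩
    · exact ⟨h, hh, by simp, by simp⟩

/-! ### The realizable case -/

/-- A fixed pattern of losses on a sample and a ghost sample: few exchanges move all the losses, of
which there are at least `r`, to the ghost sample. -/
theorem card_exchanges_le {m : ℕ} (u w : Fin m → Prop) (r : ℝ) :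
    (({σ : Fin m → Bool | (∀ i, ¬ if σ i then u i else w i) ∧
      r ≤ ({i | if σ i then w i else u i}.ncard : ℕ)}.ncard : ℕ) : ℝ) ≤
      2 ^ m * Real.exp (-(Real.log 2 * r)) := by
  classical
  set A : Finset (Fin m) := Finset.univ.filter fun i => u i ∨ w i with hA
  by_cases hr : r ≤ A.card
  swap
  · -- There are fewer than `r` losses, so no exchange qualifies.
    have : {σ : Fin m → Bool | (∀ i, ¬ if σ i then u i else w i) ∧
        r ≤ ({i | if σ i then w i else u i}.ncard : ℕ)} = ∅ := by
      refine Set.eq_empty_of_forall_notMem fun σ hσ => hr (hσ.2.trans ?_)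
      rw [Set.ncard_eq_toFinset_card']
      refine Nat.cast_le.2 (Finset.card_le_card fun i hi => ?_)
      simp only [Set.mem_toFinset, Set.mem_ofPred_eq] at hi
      simp only [hA, Finset.mem_filter, Finset.mem_univ, true_and]
      split_ifs at hi
      · exact Or.inr hi
      · exact Or.inl hi
    rw [this]
    simp only [Set.ncard_empty, Nat.cast_zero]
    positivity
  have hsub : {σ : Fin m → Bool | (∀ i, ¬ if σ i then u i else w i) ∧
      r ≤ ({i | if σ i then w i else u i}.ncard : ℕ)} ⊆
      (Fintype.piFinset fun i => Finset.univ.filter fun b : Bool => ¬ if b then u i else w i :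
        Finset (Fin m → Bool)) := by
    intro σ hσ
    simpa using hσ.1
  have h1 : (Fintype.piFinset fun i => Finset.univ.filter fun b : Bool =>
      ¬ if b then u i else w i).card * 2 ^ A.card ≤ 2 ^ m := by
    have e1 : 2 ^ A.card = ∏ i : Fin m, if u i ∨ w i then 2 else 1 := by
      rw [Finset.prod_ite]
      simp [hA]
    have e2 : 2 ^ m = ∏ _i : Fin m, 2 := by simp
    rw [Fintype.card_piFinset, e1, e2, ← Finset.prod_mul_distrib]
    refine Finset.prod_le_prod' fun i _ => ?_
    by_cases hu : u i <;> by_cases hw : w i <;>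
      simp [hu, hw, Finset.filter_eq', Finset.univ, Fintype.elems]
  have h2 : (({σ : Fin m → Bool | (∀ i, ¬ if σ i then u i else w i) ∧
      r ≤ ({i | if σ i then w i else u i}.ncard : ℕ)}.ncard : ℕ) : ℝ) * 2 ^ A.card ≤ 2 ^ m := by
    refine le_trans ?_ (Nat.cast_le.2 h1 |>.trans (by push_cast; exact le_rfl))
    push_cast
    gcongr
    exact (Set.ncard_le_ncard hsub (Finset.finite_toSet _)).trans (by rw [Set.ncard_coe_finset])
  have h3 : Real.exp (Real.log 2 * r) ≤ 2 ^ A.card := by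
    rw [← Real.exp_log (by norm_num : (0 : ℝ) < 2), ← Real.exp_nat_mul, Real.exp_log (by norm_num),
      mul_comm]
    gcongr
  rw [Real.exp_neg, ← div_eq_mul_inv, le_div_iff₀ (Real.exp_pos _)]
  refine le_trans ?_ h2
  gcongr

/-- Few exchanges of a fixed pair of samples produce a hypothesis that is consistent with the
first sample and errs at least `r` times on the second. -/
theorem ncard_exchanges_consistent_le {X Y : Type*} [Fintype Y] {m d : ℕ} {H : Set (X → Y)}
    (hH : natarajanDim H ≤ d) (S S' : Fin m → X × Y) (r : ℝ) {t : ℝ} (ht : 0 < t) (ht1 : t ≤ 1) :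
    (({σ : Fin m → Bool | ∃ h ∈ H, (∀ i, h (mix σ S S' i).1 = (mix σ S S' i).2) ∧
      r ≤ count (mistakes h) (mix σ S' S)}.ncard : ℕ) : ℝ) ≤
      2 ^ m * (t⁻¹ ^ d * Real.exp (t * (2 * (Fintype.card Y : ℝ) ^ 2 * m)) *
        Real.exp (-(Real.log 2 * r))) := by
  classical
  set Φ : (X → Y) → (Fin m → Prop) × (Fin m → Prop) := fun h =>
    (fun i => S i ∈ mistakes h, fun i => S' i ∈ mistakes h) with hΦ
  obtain ⟨hfin, hcard⟩ := ncard_image_le hH Φ S S' (fun h h' h1 h2 => by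
    simp only [hΦ, mistakes, Set.mem_ofPred_eq, h1, h2]) ht ht1
  set V := hfin.toFinset with hV
  set F : (Fin m → Prop) × (Fin m → Prop) → Set (Fin m → Bool) := fun v =>
    {σ | (∀ i, ¬ if σ i then v.1 i else v.2 i) ∧
      r ≤ ({i | if σ i then v.2 i else v.1 i}.ncard : ℕ)} with hF
  have hsub : {σ : Fin m → Bool | ∃ h ∈ H, (∀ i, h (mix σ S S' i).1 = (mix σ S S' i).2) ∧
      r ≤ count (mistakes h) (mix σ S' S)} ⊆ (V.biUnion fun v => (F v).toFinset : Finset _) := by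
    rintro σ ⟨h, hh, hcons, hr⟩
    refine Finset.mem_coe.2 (Finset.mem_biUnion.2 ⟨Φ h, by simpa [hV] using ⟨h, hh, rfl⟩, ?_⟩)
    rw [Set.mem_toFinset]
    refine ⟨fun i => ?_, ?_⟩
    · have := hcons i
      simp only [mix] at this
      simp only [hΦ, mistakes, Set.mem_ofPred_eq]
      split_ifs with hσ
      · simpa [hσ] using this
      · simpa [hσ] using this
    · refine hr.trans (le_of_eq ?_)
      rw [count]
      congr 2
      ext i
      simp only [mix, hΦ, Set.mem_ofPred_eq]
      split_ifs <;> rfl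
  calc _ ≤ ∑ v ∈ V, (((F v).ncard : ℕ) : ℝ) := by
        simp only [Set.ncard_eq_toFinset_card' (F _)]
        refine (Nat.cast_le.2 (Set.ncard_le_ncard hsub (Finset.finite_toSet _))).trans ?_
        rw [Set.ncard_coe_finset]
        exact_mod_cast Finset.card_biUnion_le
    _ ≤ ∑ _v ∈ V, 2 ^ m * Real.exp (-(Real.log 2 * r)) :=
        Finset.sum_le_sum fun v _ => card_exchanges_le v.1 v.2 r
    _ = V.card * (2 ^ m * Real.exp (-(Real.log 2 * r))) := by
        rw [Finset.sum_const, nsmul_eq_mul]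
    _ ≤ t⁻¹ ^ d * Real.exp (t * (2 * (Fintype.card Y : ℝ) ^ 2 * m)) *
        (2 ^ m * Real.exp (-(Real.log 2 * r))) := by
        gcongr
        rw [hV, ← Set.ncard_eq_toFinset_card _ hfin]
        exact hcard
    _ = _ := by ring

theorem pacLoss_eq_err {X Y : Type*} (D : PMF X) (h g : X → Y) :
    pacLoss D h g = err (labeled D h) g := by
  rw [pacLoss, err, labeled, PMF.toOuterMeasure_map_apply]
  rfl

/-- The samples that are consistent with a hypothesis in `H` of large error are unlikely. -/
theorem toOuterMeasure_consistent_le {X Y : Type*} [Fintype Y] {m d : ℕ} {H : Set (X → Y)}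
    (hH : natarajanDim H ≤ d) (P : PMF (X × Y)) {ε : ℝ} (hm : 6 ≤ ε * m) {t : ℝ}
    (ht : 0 < t) (ht1 : t ≤ 1) :
    (iid P m).toOuterMeasure {S | ∃ h ∈ H, (∀ i, h (S i).1 = (S i).2) ∧ ε < err P h} ≤
      ENNReal.ofReal (2 * (t⁻¹ ^ d * Real.exp (t * (2 * (Fintype.card Y : ℝ) ^ 2 * m)) *
        Real.exp (-(Real.log 2 * (ε * m / 2))))) := by
  refine toOuterMeasure_le_of_symmetrization P _
    (fun S S' => ∃ h ∈ H, (∀ i, h (S i).1 = (S i).2) ∧ ε * m / 2 ≤ count (mistakes h) S') ?_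
    fun S S' => ncard_exchanges_consistent_le hH S S' _ ht ht1
  rintro S ⟨h, hh, hcons, herr⟩
  refine (MeasureTheory.measure_mono (Set.compl_subset_compl.2 fun S' hS' => ?_)).trans
    (toOuterMeasure_count_lt_le P (mistakes h) herr.le hm)
  exact ⟨h, hh, hcons, hS'⟩

/-- A learner that outputs a hypothesis consistent with the sample. -/
theorem exists_consistent_learner {X Y : Type*} [Nonempty Y] (H : Set (X → Y)) (m : ℕ) :
    ∃ A : (Fin m → X × Y) → (X → Y), ∀ S, (∃ h ∈ H, ∀ i, h (S i).1 = (S i).2) →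
      A S ∈ H ∧ ∀ i, A S (S i).1 = (S i).2 := by
  have : ∀ S : Fin m → X × Y, ∃ g : X → Y, (∃ h ∈ H, ∀ i, h (S i).1 = (S i).2) →
      g ∈ H ∧ ∀ i, g (S i).1 = (S i).2 := fun S => by
    by_cases h : ∃ h ∈ H, ∀ i, h (S i).1 = (S i).2
    · obtain ⟨g, hg⟩ := h
      exact ⟨g, fun _ => hg⟩
    · exact ⟨fun _ => Classical.arbitrary Y, fun h' => absurd h' h⟩
  choose A hA using this
  exact ⟨A, hA⟩

/-- A consistent learner fails only on samples that some hypothesis of large error also fits;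
samples that the target does not fit have probability zero. -/
theorem isPAC_of_consistent {X Y : Type*} {m : ℕ} {H : Set (X → Y)}
    {A : (Fin m → X × Y) → (X → Y)}
    (hA : ∀ S, (∃ h ∈ H, ∀ i, h (S i).1 = (S i).2) → A S ∈ H ∧ ∀ i, A S (S i).1 = (S i).2)
    {ε δ : ℝ} (hδ : 0 ≤ δ)
    (hbad : ∀ (D : PMF X), ∀ h ∈ H, (iid (labeled D h) m).toOuterMeasure
      {S | ∃ g ∈ H, (∀ i, g (S i).1 = (S i).2) ∧ ε < err (labeled D h) g} ≤ ENNReal.ofReal δ) :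
    (QuantumLearner.measureThenRun A).IsPAC ε δ H := by
  classical
  intro D h hh
  refine le_trans ?_ (prob_computationalBasis (labeled D h) m _).ge
  refine ofReal_one_sub_le_toOuterMeasure _ hδ (le_trans ?_ (hbad D h hh))
  refine PMF.toOuterMeasure_mono _ fun S hS => ?_
  obtain ⟨hS1, hS2⟩ := hS
  -- Every sample in the support is labelled by `h`.
  have hcons : ∀ i, h (S i).1 = (S i).2 := by
    intro i
    by_contra hne
    refine (PMF.mem_support_iff _ _).1 hS2 ?_
    rw [iid_apply]
    refine Finset.prod_eq_zero (Finset.mem_univ i) ?_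
    rw [← Prod.mk.eta (p := S i), labeled_apply, if_neg (Ne.symm hne)]
  obtain ⟨h1, h2⟩ := hA S ⟨h, hh, hcons⟩
  refine ⟨A S, h1, h2, ?_⟩
  rw [← pacLoss_eq_err]
  exact not_le.1 hS1

/-! ### The agnostic case -/

/-- The difference of the losses of `h` on a sample and on a ghost sample, entry by entry. -/
def lossDiff {X Y : Type*} {m : ℕ} (S S' : Fin m → X × Y) (h : X → Y) : Fin m → ℝ := fun i =>
  (mistakes h).indicator (fun _ => (1 : ℝ)) (S i) -
    (mistakes h).indicator (fun _ => (1 : ℝ)) (S' i)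

theorem abs_lossDiff_le {X Y : Type*} {m : ℕ} (S S' : Fin m → X × Y) (h : X → Y) (i : Fin m) :
    |lossDiff S S' h i| ≤ 1 := by
  classical
  simp only [lossDiff, Set.indicator_apply]
  split_ifs <;> norm_num

/-- Exchanging entries of the two samples flips signs in the difference of their error counts. -/
theorem count_mix_sub {X Y : Type*} {m : ℕ} (S S' : Fin m → X × Y) (h : X → Y)
    (σ : Fin m → Bool) :
    (count (mistakes h) (mix σ S S') : ℝ) - count (mistakes h) (mix σ S' S) =
      ∑ i, sgn (σ i) * lossDiff S S' h i := by
  rw [count_eq_sum, count_eq_sum, ← Finset.sum_sub_distrib]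
  refine Finset.sum_congr rfl fun i _ => ?_
  simp only [mix, sgn, lossDiff]
  split_ifs <;> ring

/-- The chaining bound applied to the loss differences of `H` on a fixed pair of samples. -/
theorem ncard_exchanges_deviation_le {X Y : Type*} [Fintype Y] [Nonempty Y] {m d : ℕ}
    {H : Set (X → Y)} (hH : natarajanDim H ≤ d) (hm : 0 < m) (S S' : Fin m → X × Y) {τ q : ℝ}
    (hτ : 0 ≤ τ) (hq : 0 ≤ q)
    (hKq : ∀ j : ℕ, 2 * (Real.exp (1 / 2) *
      ((8 * (Fintype.card Y : ℝ) ^ 2 / (4 ^ j : ℝ)⁻¹) ^ d) ^ 2) *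
        Real.exp (-(τ ^ 2 / (32 * m) * (9 / 4) ^ j)) ≤ q * (1 / 2) ^ (j + 1)) :
    (({σ : Fin m → Bool | ∃ h ∈ H, 4 * τ < |(count (mistakes h) (mix σ S S') : ℝ) -
      count (mistakes h) (mix σ S' S)|}.ncard : ℕ) : ℝ) ≤ 2 ^ m * q := by
  classical
  have hcongr : ∀ {n : ℕ} (R R' : Fin n → X × Y) (h h' : X → Y),
      (∀ i, h (R i).1 = h' (R i).1) → (∀ i, h (R' i).1 = h' (R' i).1) →
      lossDiff R R' h = lossDiff R R' h' := fun R R' h h' h1 h2 => by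
    funext i
    simp only [lossDiff, Set.indicator_apply, mistakes, Set.mem_ofPred_eq, h1, h2]
  have hfin := (ncard_image_le hH _ S S' (hcongr S S') one_pos le_rfl).1
  have hB : (1 : ℝ) ≤ (Fintype.card Y : ℝ) ^ 2 :=
    one_le_pow₀ (by exact_mod_cast Fintype.card_pos)
  have hchain := card_chaining_le hm hfin.toFinset (fun v hv i => by
      obtain ⟨h, _, rfl⟩ := hfin.mem_toFinset.1 hv
      exact abs_lossDiff_le S S' h i) hτ hq
    (fun j => Real.exp (1 / 2) * ((8 * (Fintype.card Y : ℝ) ^ 2 / (4 ^ j : ℝ)⁻¹) ^ d) ^ 2)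
    (fun j U hU hsep => card_separated_le hB (by positivity)
      (inv_le_one_of_one_le₀ (one_le_pow₀ (by norm_num))) U (fun M I t ht ht1 => by
        obtain ⟨hfin', hcard⟩ :=
          ncard_image_le hH _ (S ∘ I) (S' ∘ I) (hcongr (S ∘ I) (S' ∘ I)) ht ht1
        refine le_trans (Nat.cast_le.2 ?_) hcard
        rw [Set.ncard_eq_toFinset_card _ hfin']
        refine Finset.card_le_card fun v hv => ?_
        obtain ⟨u, hu, rfl⟩ := Finset.mem_image.1 hv
        obtain ⟨h, hh, rfl⟩ := hfin.mem_toFinset.1 (hU hu)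
        exact hfin'.mem_toFinset.2 ⟨h, hh, rfl⟩) hsep) hKq
  refine le_trans (Nat.cast_le.2 ?_) hchain
  rw [Set.ncard_eq_toFinset_card']
  refine Finset.card_le_card fun σ hσ => ?_
  obtain ⟨h, hh, hlt⟩ := Set.mem_toFinset.1 hσ
  rw [count_mix_sub] at hlt
  exact Finset.mem_filter.2 ⟨Finset.mem_univ _, _, hfin.mem_toFinset.2 ⟨h, hh, rfl⟩, hlt⟩

/-- Uniform convergence: samples on which some empirical error is far from the true error are
unlikely. -/
theorem toOuterMeasure_deviation_le {X Y : Type*} [Fintype Y] [Nonempty Y] {m d : ℕ}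
    {H : Set (X → Y)} (hH : natarajanDim H ≤ d) (P : PMF (X × Y)) {ε q : ℝ} (hε : 0 < ε)
    (hε1 : ε ≤ 1) (hm : 6 ≤ (ε / 4) ^ 2 * m) (hq : 0 ≤ q)
    (hKq : ∀ j : ℕ, 2 * (Real.exp (1 / 2) *
      ((8 * (Fintype.card Y : ℝ) ^ 2 / (4 ^ j : ℝ)⁻¹) ^ d) ^ 2) *
        Real.exp (-((ε / 16 * m) ^ 2 / (32 * m) * (9 / 4) ^ j)) ≤ q * (1 / 2) ^ (j + 1)) :
    (iid P m).toOuterMeasure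
      {S | ∃ h ∈ H, ε / 2 * m < |(count (mistakes h) S : ℝ) - err P h * m|} ≤
      ENNReal.ofReal (2 * q) := by
  have hm0 : 0 < m := by
    rcases Nat.eq_zero_or_pos m with rfl | h
    · norm_num at hm
    · exact h
  refine toOuterMeasure_le_of_symmetrization P _
    (fun S S' => ∃ h ∈ H, 4 * (ε / 16 * m) <
      |(count (mistakes h) S : ℝ) - count (mistakes h) S'|) ?_
    fun S S' => ncard_exchanges_deviation_le hH hm0 S S' (by positivity) hq hKq
  rintro S ⟨h, hh, hdev⟩
  refine (MeasureTheory.measure_mono (Set.compl_subset_compl.2 fun S' hS' => ?_)).trans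
    (toOuterMeasure_lt_abs_count_sub_le P (mistakes h) (ε := ε / 4) (by linarith) (by linarith) hm)
  refine ⟨h, hh, ?_⟩
  have h1 : |(count (mistakes h) S' : ℝ) - err P h * m| ≤ ε / 4 * m := hS'
  have h2 := abs_sub_le (count (mistakes h) S : ℝ) (count (mistakes h) S') (err P h * m)
  linarith

/-- A learner that minimizes the empirical error. -/
theorem exists_erm {X Y : Type*} {H : Set (X → Y)} (hne : H.Nonempty) (m : ℕ) :
    ∃ A : (Fin m → X × Y) → (X → Y), ∀ S, A S ∈ H ∧
      ∀ h ∈ H, count (mistakes (A S)) S ≤ count (mistakes h) S :=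
  ⟨fun S => Function.argminOn (fun h => count (mistakes h) S) H hne, fun S =>
    ⟨Function.argminOn_mem _ _ _, fun _ hh =>
      Function.argminOn_le (fun h => count (mistakes h) S) H hh⟩⟩

/-- The regret of an empirical minimizer is at most twice the largest deviation of an empirical
error. -/
theorem isAgnostic_of_erm {X Y : Type*} {m : ℕ} (hm : 0 < m) {H : Set (X → Y)}
    {A : (Fin m → X × Y) → (X → Y)}
    (hA : ∀ S, A S ∈ H ∧ ∀ h ∈ H, count (mistakes (A S)) S ≤ count (mistakes h) S)
    {ε δ : ℝ} (hδ : 0 ≤ δ)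
    (hbad : ∀ P : PMF (X × Y), (iid P m).toOuterMeasure
      {S | ∃ h ∈ H, ε / 2 * m < |(count (mistakes h) S : ℝ) - err P h * m|} ≤
        ENNReal.ofReal δ) :
    (QuantumLearner.measureThenRun A).IsAgnostic ε δ H := by
  intro P
  refine le_trans ?_ (prob_computationalBasis P m _).ge
  refine ofReal_one_sub_le_toOuterMeasure _ hδ (le_trans ?_ (hbad P))
  refine MeasureTheory.measure_mono fun S hS => ?_
  by_contra hgood
  refine hS ?_
  have hdev : ∀ h ∈ H, |(count (mistakes h) S : ℝ) - err P h * m| ≤ ε / 2 * m := by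
    intro h hh
    by_contra! hlt
    exact hgood ⟨h, hh, hlt⟩
  obtain ⟨hAS, hmin⟩ := hA S
  have hm' : (0 : ℝ) < m := by exact_mod_cast hm
  have : Nonempty H := ⟨⟨A S, hAS⟩⟩
  have hle : err P (A S) - ε ≤ ⨅ h : H, err P h := by
    refine le_ciInf fun h => ?_
    have h1 := abs_le.1 (hdev _ hAS)
    have h2 := abs_le.1 (hdev _ h.2)
    have h3 : (count (mistakes (A S)) S : ℝ) ≤ count (mistakes (h : X → Y)) S := by
      exact_mod_cast hmin _ h.2
    refine le_of_mul_le_mul_right ?_ hm'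
    linarith
  change err P (A S) - _ ≤ ε
  linarith

/-! ### Sample sizes -/

theorem one_lt_log_of_two_lt {k : ℕ} (hk : 2 < k) : 1 < Real.log k := by
  rw [Real.lt_log_iff_exp_lt (by positivity)]
  have : (3 : ℝ) ≤ k := by exact_mod_cast hk
  linarith [Real.exp_one_lt_d9]

/-- The failure probability in the realizable case, with the parameter of the growth bound chosen
so that its exponential factor costs only `ε m / 8`. -/
theorem realizable_failure_le {d k m : ℕ} {ε δ L : ℝ} (hd : 1 ≤ d) (hk : 2 < k) (hε : 0 < ε)
    (hδ : 0 < δ) (hw : 0 ≤ Real.log (1 / δ)) (hL : 0 < L) (hεL : L ≤ Real.log (1 / ε))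
    (hm : 5 * (5.5 / L + 1) * (d * Real.log k * Real.log (1 / ε) + Real.log (1 / δ)) ≤ ε * m) :
    2 * ((ε / (16 * k ^ 2))⁻¹ ^ d * Real.exp (ε / (16 * k ^ 2) * (2 * (k : ℝ) ^ 2 * m)) *
      Real.exp (-(Real.log 2 * (ε * m / 2)))) ≤ δ := by
  have hk0 : (0 : ℝ) < k := by exact_mod_cast (by omega : 0 < k)
  have hd' : (1 : ℝ) ≤ d := by exact_mod_cast hd
  have hlk := one_lt_log_of_two_lt hk
  have h2 := Real.log_two_gt_d9
  have h2' := Real.log_two_lt_d9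
  have e1 : (ε / (16 * (k : ℝ) ^ 2))⁻¹ ^ d =
      Real.exp (d * (4 * Real.log 2 + 2 * Real.log k + Real.log (1 / ε))) := by
    rw [Real.exp_nat_mul]
    congr 1
    rw [Real.exp_add, Real.exp_add, Real.exp_log (by positivity), mul_comm 4, mul_comm 2,
      Real.exp_mul, Real.exp_mul, Real.exp_log (by norm_num), Real.exp_log hk0]
    norm_num
    field_simp
  have e2 : ε / (16 * (k : ℝ) ^ 2) * (2 * (k : ℝ) ^ 2 * m) = ε * m / 8 := by
    field_simp
    ring
  have e3 : δ = Real.exp (-Real.log (1 / δ)) := by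
    rw [one_div, Real.log_inv, neg_neg, Real.exp_log hδ]
  have e4 : (2 : ℝ) = Real.exp (Real.log 2) := (Real.exp_log (by norm_num)).symm
  rw [e1, e2, e3]
  nth_rw 1 [e4]
  rw [← Real.exp_add, ← Real.exp_add, ← Real.exp_add]
  apply Real.exp_le_exp.2
  set ℓ := Real.log k
  set lam := Real.log (1 / ε)
  set w := Real.log (1 / δ)
  have hlam : 0 < lam := hL.trans_le hεL
  -- `L ≤ lam` absorbs the terms that lack a factor `log (1 / ε)`.
  have h3 : (1 : ℝ) ≤ lam / L := by rwa [one_le_div hL]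
  have h4 : (5.5 / L + 1) * (d * ℓ * lam + w) =
      5.5 * (d * ℓ) * (lam / L) + d * ℓ * lam + (5.5 / L) * w + w := by
    field_simp
    ring
  have h5 : 5.5 * (d * ℓ) ≤ 5.5 * (d * ℓ) * (lam / L) :=
    le_mul_of_one_le_right (by positivity) h3
  have h6 : (d : ℝ) ≤ d * ℓ := le_mul_of_one_le_right (by positivity) hlk.le
  have h7 : (d : ℝ) * lam ≤ d * ℓ * lam := by gcongr
  have h8 : 0 ≤ (5.5 / L) * w := mul_nonneg (by positivity) hw
  have h9 : 0 ≤ ε * m := by positivity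
  have h10 : (d : ℝ) * (4 * Real.log 2 + 2 * ℓ + lam) ≤ d * (2.8 + 2 * ℓ + lam) := by
    gcongr
    linarith
  nlinarith

/-- The failure probability of the chaining links at level `j` in the agnostic case. -/
theorem agnostic_failure_le {d k m : ℕ} {ε δ : ℝ} (hd : 1 ≤ d) (hk : 2 < k) (hε : 0 < ε)
    (hδ : 0 < δ) (hδ1 : δ < 1)
    (hm : 100000 * (d * Real.log k + Real.log (1 / δ)) ≤ ε ^ 2 * m) (j : ℕ) :
    2 * (Real.exp (1 / 2) * ((8 * (k : ℝ) ^ 2 / (4 ^ j : ℝ)⁻¹) ^ d) ^ 2) *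
      Real.exp (-((ε / 16 * m) ^ 2 / (32 * m) * (9 / 4) ^ j)) ≤ δ / 2 * (1 / 2) ^ (j + 1) := by
  have hk0 : (0 : ℝ) < k := by exact_mod_cast (by omega : 0 < k)
  have hd' : (1 : ℝ) ≤ d := by exact_mod_cast hd
  have hlk := one_lt_log_of_two_lt hk
  have h2 := Real.log_two_gt_d9
  have h2' := Real.log_two_lt_d9
  have hw : 0 ≤ Real.log (1 / δ) := Real.log_nonneg (by rw [le_div_iff₀ hδ]; linarith)
  have hm0 : (0 : ℝ) < m := by
    have : 0 < ε ^ 2 * m := lt_of_lt_of_le (by positivity) hm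
    exact pos_of_mul_pos_right this (by positivity)
  have e1 : ((8 * (k : ℝ) ^ 2 / (4 ^ j : ℝ)⁻¹) ^ d) ^ 2 =
      Real.exp (2 * (d * (3 * Real.log 2 + 2 * Real.log k + j * (2 * Real.log 2)))) := by
    rw [show (2 : ℝ) * (d * (3 * Real.log 2 + 2 * Real.log k + j * (2 * Real.log 2))) =
      (2 : ℕ) * (d * (3 * Real.log 2 + 2 * Real.log k + j * (2 * Real.log 2))) by push_cast; ring,
      Real.exp_nat_mul, Real.exp_nat_mul]
    congr 2
    rw [Real.exp_add, Real.exp_add, Real.exp_nat_mul, mul_comm 3, mul_comm 2, mul_comm 2,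
      Real.exp_mul, Real.exp_mul, Real.exp_mul, Real.exp_log (by norm_num), Real.exp_log hk0]
    norm_num
  have e2 : (ε / 16 * m) ^ 2 / (32 * m) = ε ^ 2 * m / 8192 := by
    field_simp
    ring
  have e3 : δ / 2 * (1 / 2) ^ (j + 1) =
      Real.exp (-Real.log (1 / δ) - Real.log 2 - (j + 1) * Real.log 2) := by
    rw [Real.exp_sub, Real.exp_sub, one_div δ, Real.log_inv, neg_neg, Real.exp_log hδ,
      Real.exp_log (by norm_num), show ((j : ℝ) + 1) = ((j + 1 : ℕ) : ℝ) by push_cast; ring,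
      Real.exp_nat_mul, Real.exp_log (by norm_num), one_div, inv_pow]
    rfl
  have e4 : (2 : ℝ) = Real.exp (Real.log 2) := (Real.exp_log (by norm_num)).symm
  rw [e1, e2, e3]
  nth_rw 1 [e4]
  rw [← Real.exp_add, ← Real.exp_add, ← Real.exp_add]
  apply Real.exp_le_exp.2
  -- Bernoulli's inequality: the exponent gains linearly in `j`, as does the logarithm of the
  -- packing number.
  have hb : 1 + (j : ℝ) * (5 / 4) ≤ (9 / 4) ^ j := by
    have := one_add_mul_le_pow (a := (5 / 4 : ℝ)) (by norm_num) j
    norm_num at this ⊢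
    exact this
  set ℓ := Real.log k
  set w := Real.log (1 / δ)
  have hj : (0 : ℝ) ≤ j := by positivity
  have h6 : (d : ℝ) ≤ d * ℓ := le_mul_of_one_le_right (by positivity) hlk.le
  have h7 : 12 * (d * ℓ) + w ≤ ε ^ 2 * m / 8192 := by
    have : 0 ≤ (d : ℝ) * ℓ := by positivity
    linarith
  have h8 : (12 * (d * ℓ) + w) * (1 + (j : ℝ) * (5 / 4)) ≤ ε ^ 2 * m / 8192 * (9 / 4) ^ j := by
    gcongr
  have h9 : (d : ℝ) * Real.log 2 ≤ d * 0.7 := by gcongr; linarith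
  have h10 : (j : ℝ) * (d * Real.log 2) ≤ j * (d * 0.7) := by gcongr
  have h11 : (j : ℝ) * d ≤ j * (d * ℓ) := by gcongr
  have h12 : (j : ℝ) * Real.log 2 ≤ j * (d * 0.7) := by gcongr; nlinarith
  have h13 : 0 ≤ (j : ℝ) * w := by positivity
  nlinarith

theorem exists_isPAC {X Y : Type*} [Fintype Y] (hk : 2 < Fintype.card Y) {H : Set (X → Y)}
    {d m : ℕ} (hH : natarajanDim H ≤ d) {ε δ L : ℝ} (hε : 0 < ε) (hδ : 0 < δ) (hδ1 : δ < 1)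
    (hL : 0 < L) (hεL : L ≤ Real.log (1 / ε))
    (hm : 5 * (5.5 / L + 1) * (d * Real.log (Fintype.card Y) * Real.log (1 / ε) +
      Real.log (1 / δ)) ≤ ε * m) :
    ∃ A : (Fin m → X × Y) → (X → Y), (QuantumLearner.measureThenRun A).IsPAC ε δ H := by
  have : Nonempty Y := Fintype.card_pos_iff.1 (by omega)
  have hw : 0 ≤ Real.log (1 / δ) := Real.log_nonneg (by rw [le_div_iff₀ hδ]; linarith)
  obtain ⟨A, hA⟩ := exists_consistent_learner H m
  refine ⟨A, isPAC_of_consistent hA hδ.le fun D h hh => ?_⟩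
  rcases Nat.eq_zero_or_pos d with rfl | hd
  · -- The class has only one function, so no hypothesis errs.
    have hempty : {S : Fin m → X × Y | ∃ g ∈ H, (∀ i, g (S i).1 = (S i).2) ∧
        ε < err (labeled D h) g} = ∅ := by
      refine Set.eq_empty_of_forall_notMem ?_
      rintro S ⟨g, hg, _, hlt⟩
      obtain rfl := subsingleton_of_natarajanDim_le_zero hH hg hh
      rw [← pacLoss_eq_err] at hlt
      simp [pacLoss] at hlt
      linarith
    rw [hempty, MeasureTheory.measure_empty]
    exact zero_le
  · have hlk := one_lt_log_of_two_lt hk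
    have hlog : 0 < Real.log (1 / ε) := hL.trans_le hεL
    have hε1 : ε ≤ 1 := by
      by_contra! h
      have := Real.log_nonpos (by positivity) ((div_le_one hε).2 h.le)
      linarith
    have hd' : (1 : ℝ) ≤ d := by exact_mod_cast hd
    have hm6 : 6 ≤ ε * m := by
      have h1 : L ≤ d * Real.log (Fintype.card Y) * Real.log (1 / ε) := by
        have : 1 ≤ d * Real.log (Fintype.card Y) := by nlinarith
        nlinarith
      have h2 : 5 * (5.5 / L + 1) * L ≤ ε * m := le_trans (by gcongr; linarith) hm
      have h3 : 5 * (5.5 / L + 1) * L = 27.5 + 5 * L := by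
        field_simp
        ring
      linarith
    have hk1 : (1 : ℝ) ≤ Fintype.card Y := by exact_mod_cast (by omega : 1 ≤ Fintype.card Y)
    have ht1 : ε / (16 * (Fintype.card Y : ℝ) ^ 2) ≤ 1 := by
      rw [div_le_one (by positivity)]
      nlinarith
    exact (toOuterMeasure_consistent_le hH (labeled D h) hm6 (by positivity) ht1).trans
      (ENNReal.ofReal_le_ofReal (realizable_failure_le hd hk hε hδ hw hL hεL hm))

theorem exists_isAgnostic {X Y : Type*} [Fintype Y] (hk : 2 < Fintype.card Y) {H : Set (X → Y)}
    (hne : H.Nonempty) {d m : ℕ} (hH : natarajanDim H ≤ d) {ε δ : ℝ} (hε : 0 < ε) (hε1 : ε < 1)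
    (hδ : 0 < δ) (hδ1 : δ < 1)
    (hm : 100000 * (d * Real.log (Fintype.card Y) + Real.log (1 / δ)) ≤ ε ^ 2 * m) :
    ∃ A : (Fin m → X × Y) → (X → Y), (QuantumLearner.measureThenRun A).IsAgnostic ε δ H := by
  have : Nonempty Y := Fintype.card_pos_iff.1 (by omega)
  rcases Nat.eq_zero_or_pos d with rfl | hd
  · -- The class has only one function, whose regret is zero.
    obtain ⟨h, hh⟩ := hne
    refine ⟨fun _ => h, fun P => ?_⟩
    refine le_trans ?_ (prob_computationalBasis P m _).ge
    refine ofReal_one_sub_le_toOuterMeasure _ hδ.le ?_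
    have hempty : {S : Fin m → X × Y | regret H P h ≤ ε}ᶜ = ∅ := by
      refine Set.compl_empty_iff.2 (Set.eq_univ_of_forall fun S => ?_)
      have : Nonempty H := ⟨⟨h, hh⟩⟩
      have hle : err P h ≤ ⨅ g : H, err P g := le_ciInf fun g => by
        rw [subsingleton_of_natarajanDim_le_zero hH g.2 hh]
      change err P h - _ ≤ ε
      linarith
    exact (congrArg _ hempty).trans_le (by rw [MeasureTheory.measure_empty]; exact zero_le)
  · have hlk := one_lt_log_of_two_lt hk
    have hd' : (1 : ℝ) ≤ d := by exact_mod_cast hd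
    have hw : 0 ≤ Real.log (1 / δ) := Real.log_nonneg (by rw [le_div_iff₀ hδ]; linarith)
    have h1 : (100000 : ℝ) ≤ ε ^ 2 * m := by
      have : 1 ≤ d * Real.log (Fintype.card Y) := by nlinarith
      linarith
    have hm0 : 0 < m := by
      rcases Nat.eq_zero_or_pos m with rfl | h
      · norm_num at h1
      · exact h
    obtain ⟨A, hA⟩ := exists_erm hne m
    refine ⟨A, isAgnostic_of_erm hm0 hA hδ.le fun P => ?_⟩
    refine (toOuterMeasure_deviation_le hH P hε hε1.le (by nlinarith) (q := δ / 2)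
      (by positivity) (agnostic_failure_le hd hk hε hδ hδ1 hm)).trans (le_of_eq ?_)
    congr 1
    ring

end QuantumBatch

end

theorem mainTheorem9 :
    (∀ ε₀ : ℝ, ε₀ < 1 → ∃ C : ℝ, 0 < C ∧
      ∀ (X : Type*) (Y : Type*) [Fintype Y], 2 < Fintype.card Y →
      ∀ (H : Set (X → Y)) (d : ℕ), QuantumBatch.natarajanDim H = d →
      ∀ ε δ : ℝ, 0 < ε → ε ≤ ε₀ → 0 < δ → δ < 1 →
      ∀ m : ℕ,
        C * ((d * Real.log (Fintype.card Y) * Real.log (1 / ε) + Real.log (1 / δ)) / ε) ≤ m →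
        ∃ A : (Fin m → X × Y) → (X → Y),
          (QuantumBatch.QuantumLearner.measureThenRun A).IsPAC ε δ H) ∧
    (∃ C : ℝ, 0 < C ∧
      ∀ (X : Type*) (Y : Type*) [Fintype Y], 2 < Fintype.card Y →
      ∀ (H : Set (X → Y)) (d : ℕ), H.Nonempty → QuantumBatch.natarajanDim H = d →
      ∀ ε δ : ℝ, 0 < ε → ε < 1 → 0 < δ → δ < 1 →
      ∀ m : ℕ,
        C * ((d * Real.log (Fintype.card Y) + Real.log (1 / δ)) / ε ^ 2) ≤ m →
        ∃ A : (Fin m → X × Y) → (X → Y),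
          (QuantumBatch.QuantumLearner.measureThenRun A).IsAgnostic ε δ H) := by
  refine ⟨fun ε₀ hε₀ => ?_, 100000, by norm_num, ?_⟩
  · rcases le_or_gt ε₀ 0 with h0 | h0
    · exact ⟨1, one_pos, fun X Y _ _ H d _ ε δ hε hεε₀ => absurd hε (by linarith)⟩
    have hL : 0 < Real.log (1 / ε₀) := Real.log_pos (by rw [lt_div_iff₀ h0]; linarith)
    refine ⟨5 * (5.5 / Real.log (1 / ε₀) + 1), by positivity, ?_⟩
    intro X Y _ hk H d hH ε δ hε hεε₀ hδ hδ1 m hm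
    rw [← mul_div_assoc, div_le_iff₀ hε, mul_comm (m : ℝ)] at hm
    exact QuantumBatch.exists_isPAC hk hH.le hε hδ hδ1 hL
      (Real.log_le_log (by positivity) (by gcongr)) hm
  · intro X Y _ hk H d hne hH ε δ hε hε1 hδ hδ1 m hm
    rw [← mul_div_assoc, div_le_iff₀ (by positivity), mul_comm (m : ℝ)] at hm
    exact QuantumBatch.exists_isAgnostic hk hne hH.le hε hε1 hδ hδ1 hm
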